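/- Let $G$ be a finite graph without loops, in which parallel edges are allowed, and suppose that $G$ has maximum degree at most $3$. A star edge-coloring of $G$ is an assignment of colors to the edges such that any two distinct edges with a common end receive different colors and no path and no cycle of length four (that is, with four edges) in $G$ is colored with only two colors. Then $G$ is star $7$-edge-choosable: for every assignment of a finite list $L(e)$ of colors to each edge $e$ of $G$ with $|L(e)|\ge 7$ for all $e$, there is a star edge-coloring $\sigma$ of $G$ with $\sigma(e)\in L(e)$ for every edge $e$. Equivalently, the list star chromatic index of $G$, i.e. the least $k$ such that $G$ has a star edge-coloring from every assignment of finite lists of at least $k$ colors to its edges, is at most $7$. -/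

import Mathlib

universe u v w

namespace Graph

variable {α : Type u} {β : Type v}

/-- The degree of a vertex of a multigraph: the number of edges incident with it, where a loop
counts twice. -/
noncomputable def degree (G : Graph α β) (x : α) : ℕ∞ :=
  (G.incidenceSet x).encard + (G.loopSet x).encard

/-- The maximum degree of a multigraph (`0` if it has no vertices). -/
noncomputable def maxDegree (G : Graph α β) : ℕ∞ :=
  ⨆ x ∈ G.vertexSet, G.degree x

/-- The edges `e 0, e 1, e 2, e 3` form, in this order, a path of length four: its five vertices
are pairwise distinct (hence so are its edges). -/
def IsFourPath (G : Graph α β) (e : Fin 4 → G.edgeSet) : Prop :=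
  ∃ x : Fin 5 → α, Function.Injective x ∧ ∀ i : Fin 4, G.IsLink (e i) (x i.castSucc) (x i.succ)

/-- The edges `e 0, e 1, e 2, e 3` form, in this cyclic order, a cycle of length four: its four
vertices are pairwise distinct (hence so are its edges). The sum `i + 1` is taken modulo `4`. -/
def IsFourCycle (G : Graph α β) (e : Fin 4 → G.edgeSet) : Prop :=
  ∃ x : Fin 4 → α, Function.Injective x ∧ ∀ i : Fin 4, G.IsLink (e i) (x i) (x (i + 1))

/-- A proper edge-coloring: any two distinct edges with a common end (in particular any two
parallel edges) have different colors. -/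
def IsProperEdgeColoring (G : Graph α β) {C : Type w} (σ : G.edgeSet → C) : Prop :=
  ∀ (e f : G.edgeSet) (x : α), e ≠ f → G.Inc e x → G.Inc f x → σ e ≠ σ f

/-- The edges `e 0, e 1, e 2, e 3` receive at most two colors. (In a proper coloring the edges of
a path or cycle receive at least two colors, so then this means exactly two.) -/
def IsBichromatic {G : Graph α β} {C : Type w} (σ : G.edgeSet → C) (e : Fin 4 → G.edgeSet) :
    Prop :=
  ∃ a b : C, ∀ i : Fin 4, σ (e i) = a ∨ σ (e i) = b

/-- A star edge-coloring: a proper edge-coloring with neither a bichromatic path nor a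
bichromatic cycle of length four. -/
structure IsStarEdgeColoring (G : Graph α β) {C : Type w} (σ : G.edgeSet → C) : Prop where
  proper : G.IsProperEdgeColoring σ
  not_path : ∀ e : Fin 4 → G.edgeSet, G.IsFourPath e → ¬ IsBichromatic σ e
  not_cycle : ∀ e : Fin 4 → G.edgeSet, G.IsFourCycle e → ¬ IsBichromatic σ e

/-- `G` is star `L`-edge-colorable: it has a star edge-coloring that gives each edge `e` a color
from its list `L e`. -/
def IsStarListEdgeColorable (G : Graph α β) {C : Type w} (L : G.edgeSet → Finset C) : Prop :=
  ∃ σ : G.edgeSet → C, G.IsStarEdgeColoring σ ∧ ∀ e, σ e ∈ L e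

/-- `G` is star `k`-edge-choosable: it is star `L`-edge-colorable for every edge-list-assignment
`L` all of whose lists have at least `k` colors, whatever the type `C` of colors is. -/
def IsStarEdgeChoosable (G : Graph α β) (k : ℕ) : Prop :=
  ∀ (C : Type w) (L : G.edgeSet → Finset C), (∀ e, k ≤ (L e).card) → G.IsStarListEdgeColorable L

/-- The list star chromatic index of `G`: the least `k` such that `G` is star `k`-edge-choosable
(`⊤` if there is no such `k`). -/
noncomputable def listStarChromaticIndex (G : Graph α β) : ℕ∞ :=
  ⨅ (k : ℕ) (_ : IsStarEdgeChoosable.{u, v, w} G k), (k : ℕ∞)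

end Graph

/-! Split the edges to be colored into a matching `M` and a set `F` of maximum degree two, and color
`M` so that no color of an `M`-edge recurs within distance two of it. In a proper coloring, a
two-colored path or cycle of length four alternates, so its first and third edges agree, and so do
its second and fourth. Hence such a path or cycle avoids `M`, and it is enough that `F` be star
colored on its own.

Counting gives the constant 7. An `M`-edge is joined by an `F`-edge to at most four others. An
`F`-edge has at most four `M`-edges in its `window`, so seven colors leave a residual list of at
least three. Three colors per edge suffice on paths and cycles, except on a five-cycle whose lists
are one and the same set of three colors (`exists_isStarOn_of_card_le_two`). Given the colors of the
other `M`-edges, each end of an `M`-edge excludes at most one further color for the sake of the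
five-cycle through it (`bad_color_unique`). This makes at most 4 + 2 = 6 exclusions, so `M` can be
colored greedily (`exists_matching_coloring`).

Such a splitting needs a matching covering all cubic vertices, and bridges may obstruct this. So
take a minimal nonempty vertex set `Y` with at most one edge leaving it. Smaller sets have at least
two leaving edges, which with parity yields Tutte's condition and a matching that contains the
leaving edge and covers the cubic vertices of `Y` (`exists_matching_covering`). The rest is colored
by induction. The leaving edge sees at most six edges there, so it can be colored next, and it
enters the coloring of `Y` as a precolored edge of `M` (`exists_isStarOn_insideEdges`). -/

/-! ### Cyclic words from lists of three colors. -/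

open Classical in
theorem exists_mem_ne_ne {C : Type*} {s : Finset C} (hs : 3 ≤ s.card) (p q : C) :
    ∃ z ∈ s, z ≠ p ∧ z ≠ q := by
  have : 0 < (s \ {p, q}).card := by
    have h1 := Finset.le_card_sdiff {p, q} s
    have h2 : ({p, q} : Finset C).card ≤ 2 := Finset.card_le_two
    omega
  obtain ⟨z, hz⟩ := Finset.card_pos.mp this
  simp only [Finset.mem_sdiff, Finset.mem_insert, Finset.mem_singleton, not_or] at hz
  exact ⟨z, hz.1, hz.2⟩

/-- Greedy choice from lists of three colors in which any three consecutive terms are distinct. -/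
theorem exists_seq_ne_ne {C : Type*} (R : ℕ → Finset C) (hR : ∀ i, 3 ≤ (R i).card) (a : C)
    (ha : a ∈ R 0) :
    ∃ c : ℕ → C, c 0 = a ∧ (∀ i, c i ∈ R i) ∧ (∀ i, c i ≠ c (i + 1)) ∧ ∀ i, c i ≠ c (i + 2) := by
  choose pick hmem hp hq using fun i p q => exists_mem_ne_ne (hR i) p q
  let g : ℕ → C × C := fun n => Nat.rec (a, pick 1 a a)
    (fun i pq => (pq.2, pick (i + 2) pq.1 pq.2)) n
  have g1 : ∀ i, (g (i + 1)).1 = (g i).2 := fun i => rfl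
  have g2 : ∀ i, (g (i + 1)).2 = pick (i + 2) (g i).1 (g i).2 := fun i => rfl
  refine ⟨fun i => (g i).1, rfl, ?_, ?_, ?_⟩
  · intro i
    match i with
    | 0 => exact ha
    | 1 => exact hmem 1 a a
    | i + 2 => show (g (i + 1 + 1)).1 ∈ _; rw [g1 (i + 1), g2]; exact hmem _ _ _
  · intro i
    match i with
    | 0 => exact (hp 1 a a).symm
    | i + 1 =>
      show (g (i + 1)).1 ≠ (g (i + 1 + 1)).1
      rw [g1 i, g1 (i + 1), g2]; exact (hq _ _ _).symm
  · intro i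
    show (g i).1 ≠ (g (i + 1 + 1)).1
    rw [g1 (i + 1), g2]; exact (hp _ _ _).symm

/-- A sequence of `n` colors is cyclically good if consecutive terms differ and no four consecutive
terms alternate between two colors. -/
structure IsCyclicGood {C : Type*} (n : ℕ) (c : ℕ → C) : Prop where
  ne : ∀ i, c i ≠ c (i + 1)
  quad : 4 ≤ n → ∀ i, ¬ (c i = c (i + 2) ∧ c (i + 1) = c (i + 3))

/-- Reduces the periodic extension of a word of length `n` to finitely many checks. The hypotheses
`h2` and `h4`, `h5`, `h6` are the pair and the three windows that cross the seam. -/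
theorem isCyclicGood_mod {C : Type*} {n : ℕ} (hn : 2 ≤ n) (c : ℕ → C)
    (h1 : ∀ i, i + 1 < n → c i ≠ c (i + 1)) (h2 : c (n - 1) ≠ c 0)
    (h3 : 4 ≤ n → ∀ i, i + 3 < n → ¬ (c i = c (i + 2) ∧ c (i + 1) = c (i + 3)))
    (h4 : 4 ≤ n → ¬ (c (n - 3) = c (n - 1) ∧ c (n - 2) = c 0))
    (h5 : 4 ≤ n → ¬ (c (n - 2) = c 0 ∧ c (n - 1) = c 1))
    (h6 : 4 ≤ n → ¬ (c (n - 1) = c 1 ∧ c 0 = c 2)) :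
    IsCyclicGood n (c ∘ (· % n)) := by
  have key : ∀ i k, k < n → (i + k) % n = if i % n + k < n then i % n + k else i % n + k - n := by
    intro i k hk
    have := Nat.mod_lt i (show 0 < n by omega)
    rw [Nat.add_mod, Nat.mod_eq_of_lt hk]
    split_ifs with h
    · exact Nat.mod_eq_of_lt h
    · rw [Nat.mod_eq_sub_mod (by omega), Nat.mod_eq_of_lt (by omega)]
  constructor
  · intro i
    have hlt := Nat.mod_lt i (show 0 < n by omega)
    simp only [Function.comp, key i 1 (by omega)]
    split_ifs with h
    · exact h1 _ h
    · rwa [show i % n = n - 1 by omega, show n - 1 + 1 - n = 0 by omega]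
  · intro h4n i
    have hlt := Nat.mod_lt i (show 0 < n by omega)
    simp only [Function.comp, key i 1 (by omega), key i 2 (by omega), key i 3 (by omega)]
    generalize i % n = j at *
    by_cases hj : j + 3 < n
    · simpa only [hj, show j + 2 < n by omega, show j + 1 < n by omega, if_true] using h3 h4n j hj
    · have : j = n - 3 ∨ j = n - 2 ∨ j = n - 1 := by omega
      rcases this with rfl | rfl | rfl
      · simpa only [show n - 3 + 2 < n by omega, show n - 3 + 1 < n by omega, hj, if_true, if_false,
          show n - 3 + 2 = n - 1 by omega, show n - 3 + 1 = n - 2 by omega,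
          show n - 1 < n by omega,
          show n - 2 < n by omega, show n - 3 + 3 - n = 0 by omega] using h4 h4n
      · simpa only [show ¬ n - 2 + 2 < n by omega, show n - 2 + 1 < n by omega, hj, if_true,
          if_false, show n - 2 + 1 = n - 1 by omega, show n - 2 + 2 - n = 0 by omega,
          show n - 1 < n by omega, show n - 2 + 3 - n = 1 by omega] using h5 h4n
      · simpa only [show ¬ n - 1 + 2 < n by omega, show ¬ n - 1 + 1 < n by omega, hj,
          if_false, show n - 1 + 1 - n = 0 by omega, show n - 1 + 2 - n = 1 by omega,
          show n - 1 + 3 - n = 2 by omega] using h6 h4n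

/-- Start with a color `a` of the first list that is missing from the last one and proceed greedily.
The next-to-last color `p` avoids its predecessor and `a`. The last color `q` avoids the two before
it, and it differs from `a` for free. Every window, also across the seam, then contains two
different colors at distance two. -/
theorem exists_isCyclicGood_of_not_subset {C : Type*} {n : ℕ} (hn : 2 ≤ n) (R : ℕ → Finset C)
    (hper : ∀ i, R (i + n) = R i) (hR : ∀ i, 3 ≤ (R i).card) (hsub : ¬ R 0 ⊆ R (n - 1)) :
    ∃ c : ℕ → C, (∀ i, c (i + n) = c i) ∧ (∀ i, c i ∈ R i) ∧ IsCyclicGood n c := by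
  have hmod : ∀ i, R (i % n) = R i := by
    intro i
    conv_rhs => rw [← Nat.mod_add_div i n]
    generalize i / n = k
    induction k with
    | zero => simp
    | succ k ih => rw [ih, Nat.mul_succ, ← Nat.add_assoc, hper]
  obtain ⟨a, ha, ha'⟩ := Finset.not_subset.mp hsub
  obtain ⟨c, c0, cR, c1, c2⟩ := exists_seq_ne_ne R hR a ha
  suffices ∃ d : ℕ → C, (∀ i, d i ∈ R i) ∧ IsCyclicGood n (d ∘ (· % n)) by
    obtain ⟨d, hd, hg⟩ := this
    exact ⟨_, fun i => by simp, fun i => by have := hd (i % n); rwa [hmod] at this, hg⟩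
  obtain ⟨p, pR, p1, p2⟩ := exists_mem_ne_ne (hR (n - 2)) (c (n - 3)) a
  obtain ⟨q, qR, q1, q2⟩ := exists_mem_ne_ne (hR (n - 1)) p (c (n - 3))
  have qa : q ≠ a := fun h => ha' (h ▸ qR)
  rcases Nat.lt_or_ge n 3 with h3 | h3
  · obtain rfl : n = 2 := by omega
    refine ⟨_, fun i => ?_, isCyclicGood_mod le_rfl
      (fun i => if i = 0 then a else if i = 1 then q else c i) ?_ ?_ ?_ ?_ ?_ ?_⟩
    · split_ifs with h h'
      · exact h ▸ ha
      · exact h' ▸ qR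
      · exact cR i
    · intro i hi
      obtain rfl : i = 0 := by omega
      simpa using qa.symm
    · simpa using qa
    all_goals omega
  · refine ⟨_, fun i => ?_, isCyclicGood_mod hn
      (fun i => if i = n - 1 then q else if i = n - 2 then p else c i) ?_ ?_ ?_ ?_ ?_ ?_⟩
    · split_ifs with h h'
      · exact h ▸ qR
      · exact h' ▸ pR
      · exact cR i
    · intro i hi
      by_cases hi1 : i + 1 = n - 1
      · obtain rfl : i = n - 2 := by omega
        simpa [hi1, show n - 2 ≠ n - 1 by omega] using q1.symm
      by_cases hi2 : i + 1 = n - 2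
      · obtain rfl : i = n - 3 := by omega
        simpa [hi2, show n - 3 ≠ n - 1 by omega, show n - 3 ≠ n - 2 by omega,
          show n - 2 ≠ n - 1 by omega] using p1.symm
      · simpa [hi1, hi2, show i ≠ n - 1 by omega, show i ≠ n - 2 by omega] using c1 i
    · simpa [show 0 ≠ n - 1 by omega, show 0 ≠ n - 2 by omega, c0] using qa
    · rintro h4 i hi ⟨e1, e2⟩
      by_cases hi1 : i + 3 = n - 1
      · simp [hi1, show i + 1 ≠ n - 1 by omega, show i + 1 ≠ n - 2 by omega] at e2
        exact q2 (by rw [← e2]; congr 1; omega)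
      · simp [show i + 2 ≠ n - 1 by omega, show i + 2 ≠ n - 2 by omega, show i ≠ n - 1 by omega,
          show i ≠ n - 2 by omega] at e1
        exact c2 i e1
    · rintro h4 ⟨e1, e2⟩
      simp [show n - 3 ≠ n - 1 by omega, show n - 3 ≠ n - 2 by omega] at e1
      exact q2 e1.symm
    · rintro h4 ⟨e1, e2⟩
      simp [show n - 2 ≠ n - 1 by omega, show 0 ≠ n - 1 by omega, show 0 ≠ n - 2 by omega, c0] at e1
      exact p2 e1
    · rintro h4 ⟨e1, e2⟩
      by_cases hn4 : 2 = n - 2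
      · simp [hn4.symm, show 0 ≠ n - 1 by omega, show 2 ≠ n - 1 by omega, c0] at e2
        exact p2 e2.symm
      · simp [hn4, show 0 ≠ n - 1 by omega, show 0 ≠ n - 2 by omega, show 2 ≠ n - 1 by omega] at e2
        exact c2 0 e2

/-- For equal lists the words are explicit: blocks `012`, preceded by one block `0102` if `n % 3 =
1` and by two if `n % 3 = 2`. The length 5 is not of the form 3a + 4b, and the word `01023` used for
it needs a fourth color. The length 2 is covered by the start of `012`. -/
theorem exists_isCyclicGood_const {C : Type*} {n : ℕ} (hn : 2 ≤ n) (A : Finset C)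
    (hA : 3 ≤ A.card) (h5 : n = 5 → A.card ≠ 3) :
    ∃ c : ℕ → C, (∀ i, c (i + n) = c i) ∧ (∀ i, c i ∈ A) ∧ IsCyclicGood n c := by
  suffices ∃ d : ℕ → ℕ, (∀ i, d i < A.card) ∧ IsCyclicGood n (d ∘ (· % n)) by
    obtain ⟨d, hd, hg⟩ := this
    let φ := A.equivFin.symm
    have hφ : ∀ i j, (φ ⟨d i, hd i⟩ : C) = φ ⟨d j, hd j⟩ ↔ d i = d j := by
      intro i j
      rw [Subtype.coe_inj, φ.apply_eq_iff_eq, Fin.mk.injEq]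
    refine ⟨fun i => φ ⟨d (i % n), hd _⟩, fun i => by simp, fun i => (φ _).2, ⟨fun i => ?_, ?_⟩⟩
    · rw [Ne, hφ]; exact hg.ne i
    · intro h4 i
      rw [hφ, hφ]; exact hg.quad h4 i
  by_cases hn5 : n = 5
  · have := h5 hn5
    subst hn5
    refine ⟨_, fun i => ?_, isCyclicGood_mod hn (fun i => if i = 0 then 0 else if i = 1 then 1 else
      if i = 2 then 0 else if i = 3 then 2 else 3) ?_ ?_ ?_ ?_ ?_ ?_⟩
    · split_ifs <;> omega
    · intro i hi
      obtain rfl | rfl | rfl | rfl : i = 0 ∨ i = 1 ∨ i = 2 ∨ i = 3 := by omega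
      all_goals simp
    · simp
    · intro _ i hi
      obtain rfl | rfl : i = 0 ∨ i = 1 := by omega
      all_goals simp
    all_goals simp
  obtain h | h | h : (n % 3 = 0 ∨ n = 2) ∨ (n % 3 = 1 ∧ 4 ≤ n) ∨ (n % 3 = 2 ∧ 8 ≤ n) := by omega
  · refine ⟨_, fun i => ?_, isCyclicGood_mod hn
      (fun i => i % 3) ?_ ?_ ?_ ?_ ?_ ?_⟩
    all_goals omega
  · refine ⟨_, fun i => ?_, isCyclicGood_mod hn
      (fun i => if i < 4 then (if i % 2 = 0 then 0 else if i % 4 = 1 then 1 else 2)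
        else (i + 2) % 3) ?_ ?_ ?_ ?_ ?_ ?_⟩
    · split_ifs <;> omega
    · intro i hi; split_ifs <;> omega
    · split_ifs <;> omega
    · intro h4 i hi
      rcases Nat.lt_or_ge i 4 with h8 | h8
      · obtain rfl | rfl | rfl | rfl : i = 0 ∨ i = 1 ∨ i = 2 ∨ i = 3 := by omega
        all_goals simp
      · simp only [show ¬ i < 4 by omega, show ¬ i + 1 < 4 by omega, show ¬ i + 2 < 4 by omega,
          show ¬ i + 3 < 4 by omega, if_false]
        omega
    all_goals
      intro _
      rcases (by omega : n = 4 ∨ 7 ≤ n) with rfl | hk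
      · simp
      · simp only [show ¬ n - 1 < 4 by omega, show ¬ n - 2 < 4 by omega,
          show ¬ n - 3 < 4 by omega, if_false]
        simp
        try omega
  · refine ⟨_, fun i => ?_, isCyclicGood_mod hn
      (fun i => if i < 8 then (if i % 2 = 0 then 0 else if i % 4 = 1 then 1 else 2)
        else (i + 1) % 3) ?_ ?_ ?_ ?_ ?_ ?_⟩
    · split_ifs <;> omega
    · intro i hi; split_ifs <;> omega
    · split_ifs <;> omega
    · intro h4 i hi
      rcases Nat.lt_or_ge i 8 with h8 | h8
      · obtain rfl | rfl | rfl | rfl | rfl | rfl | rfl | rfl : i = 0 ∨ i = 1 ∨ i = 2 ∨ i = 3 ∨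
          i = 4 ∨ i = 5 ∨ i = 6 ∨ i = 7 := by omega
        all_goals simp
      · simp only [show ¬ i < 8 by omega, show ¬ i + 1 < 8 by omega, show ¬ i + 2 < 8 by omega,
          show ¬ i + 3 < 8 by omega, if_false]
        omega
    all_goals
      intro _
      rcases (by omega : n = 8 ∨ 11 ≤ n) with rfl | hk
      · simp
      · simp only [show ¬ n - 1 < 8 by omega, show ¬ n - 2 < 8 by omega,
          show ¬ n - 3 < 8 by omega, if_false]
        simp
        try omega

/-- Cycles are star edge-colorable from lists of three colors, except that all lists of a
five-cycle must not be the same set of three colors. -/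
theorem exists_isCyclicGood {C : Type*} {n : ℕ} (hn : 2 ≤ n) (R : ℕ → Finset C)
    (hper : ∀ i, R (i + n) = R i) (hR : ∀ i, 3 ≤ (R i).card)
    (h5 : n = 5 → ¬ ((∀ i, R i = R 0) ∧ (R 0).card = 3)) :
    ∃ c : ℕ → C, (∀ i, c (i + n) = c i) ∧ (∀ i, c i ∈ R i) ∧ IsCyclicGood n c := by
  have hperk : ∀ k i, R (i + k * n) = R i := by
    intro k i
    induction k with
    | zero => simp
    | succ k ih => rw [Nat.succ_mul, ← Nat.add_assoc, hper, ih]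
  by_cases hall : ∀ i, R (i + 1) ⊆ R i
  -- A cyclic chain of inclusions forces all lists to be equal.
  · have hle : ∀ i k, R (i + k) ⊆ R i := by
      intro i k
      induction k with
      | zero => simp
      | succ k ih => exact (hall (i + k)).trans ih
    have heq : ∀ i, R i = R 0 := by
      intro i
      refine (by simpa using hle 0 i : R i ⊆ R 0).antisymm ?_
      have := hle i (i * (n - 1))
      rwa [show i + i * (n - 1) = 0 + i * n by
        obtain ⟨m, rfl⟩ : ∃ m, n = m + 1 := ⟨n - 1, by omega⟩
        simp only [Nat.add_sub_cancel]; ring, hperk] at this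
    obtain ⟨c, hc1, hc2, hc3⟩ := exists_isCyclicGood_const hn (R 0) (hR 0)
      fun h h' => h5 h ⟨heq, h'⟩
    exact ⟨c, hc1, fun i => heq i ▸ hc2 i, hc3⟩
  · push Not at hall
    obtain ⟨k, hk⟩ := hall
    -- Rotate so that the failing inclusion sits at the seam. The shift by `(k + 1) * (n - 1)` below
    -- undoes this rotation modulo `n`.
    obtain ⟨c, hc1, hc2, hc3⟩ := exists_isCyclicGood_of_not_subset hn (fun i => R (i + (k + 1)))
      (fun i => by rw [← hper (i + (k + 1)), Nat.add_right_comm]) (fun i => hR _)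
      (by simpa only [Nat.zero_add, show n - 1 + (k + 1) = k + n by omega, hper] using hk)
    refine ⟨fun i => c (i + (k + 1) * (n - 1)), fun i => ?_, fun i => ?_, ?_⟩
    · dsimp only; rw [← hc1 (i + (k + 1) * (n - 1)), Nat.add_right_comm]
    · have := hc2 (i + (k + 1) * (n - 1))
      rwa [show i + (k + 1) * (n - 1) + (k + 1) = i + (k + 1) * n by
        obtain ⟨m, rfl⟩ : ∃ m, n = m + 1 := ⟨n - 1, by omega⟩
        simp only [Nat.add_sub_cancel]; ring, hperk] at this
    · constructor
      · intro i
        simpa only [Nat.add_right_comm] using hc3.ne (i + (k + 1) * (n - 1))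
      · intro h4 i
        simpa only [Nat.add_right_comm] using hc3.quad h4 (i + (k + 1) * (n - 1))

/-! ### Quads and cycles in multigraphs, and star coloring in maximum degree two. -/

section StarColoring

open scoped Classical

variable {V E C : Type*}

/-- Two edges (possibly equal) of a multigraph, given by its map `ends`, share an end. -/
def Touch (ends : E → Sym2 V) (a b : E) : Prop := ∃ x, x ∈ ends a ∧ x ∈ ends b

theorem Touch.symm {ends : E → Sym2 V} {a b : E} (h : Touch ends a b) : Touch ends b a :=
  h.imp fun _ h => h.symm

/-- Four consecutive edges of a path with four edges or of a four-cycle. -/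
def IsQuad (ends : E → Sym2 V) (a b c d : E) : Prop :=
  ∃ x₀ x₁ x₂ x₃ x₄, ends a = s(x₀, x₁) ∧ ends b = s(x₁, x₂) ∧ ends c = s(x₂, x₃) ∧
    ends d = s(x₃, x₄) ∧ x₀ ≠ x₁ ∧ x₀ ≠ x₂ ∧ x₀ ≠ x₃ ∧ x₁ ≠ x₂ ∧ x₁ ≠ x₃ ∧ x₁ ≠ x₄ ∧ x₂ ≠ x₃ ∧
    x₂ ≠ x₄ ∧ x₃ ≠ x₄

theorem IsQuad.reverse {ends : E → Sym2 V} {a b c d : E} (h : IsQuad ends a b c d) :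
    IsQuad ends d c b a := by
  obtain ⟨x₀, x₁, x₂, x₃, x₄, ha, hb, hc, hd, h⟩ := h
  refine ⟨x₄, x₃, x₂, x₁, x₀, ?_⟩
  rw [ha, hb, hc, hd]
  simp only [Sym2.eq_swap, true_and]
  tauto

/-- The restriction of `σ` to the edge set `S` is a star edge-coloring. -/
structure IsStarOn (ends : E → Sym2 V) (S : Finset E) (σ : E → C) : Prop where
  ne : ∀ a ∈ S, ∀ b ∈ S, a ≠ b → Touch ends a b → σ a ≠ σ b
  quad : ∀ a ∈ S, ∀ b ∈ S, ∀ c ∈ S, ∀ d ∈ S, IsQuad ends a b c d → ¬ (σ a = σ c ∧ σ b = σ d)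

/-- The periodic sequences `x` of vertices and `f` of edges describe a cycle of length `n`. -/
structure IsCyc (ends : E → Sym2 V) (n : ℕ) (x : ℕ → V) (f : ℕ → E) : Prop where
  per_x : ∀ i, x (i + n) = x i
  per_f : ∀ i, f (i + n) = f i
  link : ∀ i, ends (f i) = s(x i, x (i + 1))
  inj : ∀ i j, i < n → j < n → x i = x j → i = j
  ne : ∀ i, f i ≠ f (i + 1)

theorem eq_or_eq_of_card_le_two {ends : E → Sym2 V} {F : Finset E}
    (hF : ∀ x, (F.filter (x ∈ ends ·)).card ≤ 2) {x : V} {a b c : E} (ha : a ∈ F) (hb : b ∈ F)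
    (hc : c ∈ F) (xa : x ∈ ends a) (xb : x ∈ ends b) (xc : x ∈ ends c) (hab : a ≠ b) :
    c = a ∨ c = b := by
  by_contra! h
  refine absurd (hF x) (not_le.mpr (Finset.two_lt_card.mpr
    ⟨a, ?_, b, ?_, c, ?_, hab, h.1.symm, h.2.symm⟩))
  all_goals simp [*]

namespace IsCyc

variable {ends : E → Sym2 V} {n : ℕ} {x : ℕ → V} {f : ℕ → E}

theorem per_x_mul (h : IsCyc ends n x f) (i k : ℕ) : x (i + k * n) = x i := by
  induction k with
  | zero => simp
  | succ k ih => rw [Nat.succ_mul, ← Nat.add_assoc, h.per_x, ih]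

theorem per_f_mul (h : IsCyc ends n x f) (i k : ℕ) : f (i + k * n) = f i := by
  induction k with
  | zero => simp
  | succ k ih => rw [Nat.succ_mul, ← Nat.add_assoc, h.per_f, ih]

theorem x_mod (h : IsCyc ends n x f) (i : ℕ) : x (i % n) = x i := by
  conv_rhs => rw [← Nat.mod_add_div i n, Nat.mul_comm, h.per_x_mul]

theorem f_mod (h : IsCyc ends n x f) (i : ℕ) : f (i % n) = f i := by
  conv_rhs => rw [← Nat.mod_add_div i n, Nat.mul_comm, h.per_f_mul]

theorem mod_eq (h : IsCyc ends n x f) (hn : 0 < n) {i j : ℕ} (hij : x i = x j) :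
    i % n = j % n :=
  h.inj _ _ (Nat.mod_lt _ hn) (Nat.mod_lt _ hn) (by rw [h.x_mod, h.x_mod, hij])

theorem ne_add (h : IsCyc ends n x f) (i : ℕ) {k : ℕ} (hk : 0 < k) (hkn : k < n) :
    x i ≠ x (i + k) := by
  intro he
  have h1 := h.mod_eq (by omega) he
  have h2 : n ∣ k := by
    have := (Nat.modEq_iff_dvd' (Nat.le_add_right i k)).mp h1
    simpa using this
  exact absurd (Nat.le_of_dvd hk h2) (by omega)

theorem mem_left (h : IsCyc ends n x f) (i : ℕ) : x i ∈ ends (f i) := by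
  rw [h.link]; exact Sym2.mem_mk_left _ _

theorem mem_right (h : IsCyc ends n x f) (i : ℕ) : x (i + 1) ∈ ends (f i) := by
  rw [h.link]; exact Sym2.mem_mk_right _ _

theorem shift (h : IsCyc ends n x f) (hn : 0 < n) (k : ℕ) :
    IsCyc ends n (fun i => x (i + k)) (fun i => f (i + k)) where
  per_x i := by rw [Nat.add_right_comm, h.per_x]
  per_f i := by rw [Nat.add_right_comm, h.per_f]
  link i := by rw [h.link, Nat.add_right_comm]
  inj i j hi hj he := by
    have := Nat.ModEq.add_right_cancel' k (h.mod_eq hn he)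
    rwa [Nat.ModEq, Nat.mod_eq_of_lt hi, Nat.mod_eq_of_lt hj] at this
  ne i := by rw [Nat.add_right_comm]; exact h.ne _

theorem f_injective (h : IsCyc ends n x f) (hn : 2 ≤ n) {i j : ℕ} (hij : f i = f j) :
    i % n = j % n := by
  have he := h.link i
  rw [hij, h.link j, Sym2.eq_iff] at he
  rcases he with he | ⟨h1, h2⟩
  · exact (h.mod_eq (by omega) he.1).symm
  · exfalso
    have e1 : x j = x (j + 2) := by
      have := h.mod_eq (by omega) h2
      have : (j + 2) % n = (i + 1) % n := by
        rw [show j + 2 = j + 1 + 1 from rfl, Nat.add_mod, this, ← Nat.add_mod]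
      rw [← h.x_mod (j + 2), this, h.x_mod, ← h1]
    rcases Nat.lt_or_ge 2 n with h3 | h3
    · exact h.ne_add j (by omega) h3 e1
    -- A two-cycle is a pair of parallel edges. Their ends coincide, so only the field `ne` tells
    -- them apart.
    · obtain rfl : n = 2 := by omega
      apply h.ne j
      have := h.mod_eq (by omega) h2
      rw [← hij, ← h.f_mod i, ← this, h.f_mod]

theorem eq_of_mem (h : IsCyc ends n x f) {F : Finset E}
    (hF : ∀ x, (F.filter (x ∈ ends ·)).card ≤ 2) (hf : ∀ i, f i ∈ F) {g : E} (hg : g ∈ F) {i : ℕ}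
    (hx : x (i + 1) ∈ ends g) : g = f i ∨ g = f (i + 1) :=
  eq_or_eq_of_card_le_two hF (hf i) (hf (i + 1)) hg (h.mem_right i) (h.mem_left (i + 1)) hx (h.ne i)

/-- Stands in for the index `i - k`, which truncated subtraction would spoil. -/
theorem exists_eq_add (h : IsCyc ends n x f) (hn : 0 < n) (i k : ℕ) :
    ∃ j, ∀ l, f (i + l) = f (j + k + l) ∧ x (i + l) = x (j + k + l) := by
  refine ⟨i + k * (n - 1), fun l => ?_⟩
  have : i + k * (n - 1) + k + l = i + l + k * n := by
    obtain ⟨m, rfl⟩ : ∃ m, n = m + 1 := ⟨n - 1, by omega⟩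
    simp only [Nat.add_sub_cancel]; ring
  rw [this, h.per_f_mul, h.per_x_mul]; exact ⟨rfl, rfl⟩

theorem eq_of_touch (h : IsCyc ends n x f) (hn : 0 < n) {F : Finset E}
    (hF : ∀ x, (F.filter (x ∈ ends ·)).card ≤ 2) (hf : ∀ i, f i ∈ F) {g : E} (hg : g ∈ F) {i : ℕ}
    (ht : Touch ends (f i) g) : ∃ j, g = f j := by
  obtain ⟨y, hy, hyg⟩ := ht
  rw [h.link, Sym2.mem_iff] at hy
  rcases hy with rfl | rfl
  · obtain ⟨j, hj⟩ := h.exists_eq_add hn i 1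
    have := (hj 0).2
    simp only [Nat.add_zero] at this
    rw [this] at hyg
    rcases h.eq_of_mem hF hf hg hyg with h | h <;> exact ⟨_, h⟩
  · rcases h.eq_of_mem hF hf hg hyg with h | h <;> exact ⟨_, h⟩

/-- A quad contained in a cycle consists of four consecutive edges of it. -/
theorem quad_eq (h : IsCyc ends n x f) (hn : 2 ≤ n) {F : Finset E}
    (hF : ∀ x, (F.filter (x ∈ ends ·)).card ≤ 2) (hf : ∀ i, f i ∈ F) {a b c d : E}
    (ha : ∃ i, a = f i) (hb : b ∈ F) (hc : c ∈ F) (hd : d ∈ F) (hq : IsQuad ends a b c d) :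
    4 ≤ n ∧ ∃ j, (a = f j ∧ b = f (j + 1) ∧ c = f (j + 2) ∧ d = f (j + 3)) ∨
      (d = f j ∧ c = f (j + 1) ∧ b = f (j + 2) ∧ a = f (j + 3)) := by
  obtain ⟨x₀, x₁, x₂, x₃, x₄, ha', hb', hc', hd', h01, h02, h03, h12, h13, h14, h23, h24, h34⟩ := hq
  have key : ∀ {y z w : V} {g g' : E}, ends g = s(y, z) → ends g' = s(z, w) → y ≠ w → y ≠ z →
      g ≠ g' := by
    rintro y z w g g' h1 h2 h3 h4 rfl
    rw [h1, Sym2.eq_iff] at h2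
    rcases h2 with h2 | h2
    · exact h4 h2.1
    · exact h3 h2.1
  have hab := key ha' hb' h02 h01
  have hbc := key hb' hc' h13 h12
  have hcd := key hc' hd' h24 h23
  obtain ⟨i, rfl⟩ := ha
  have hl := h.link i
  rw [ha', Sym2.eq_iff] at hl
  rcases hl with ⟨h0, h1⟩ | ⟨h0, h1⟩
  · have step : ∀ {j : ℕ} {g : E} {y z : V}, y = x (j + 1) → ends g = s(y, z) → g ∈ F → f j ≠ g →
        g = f (j + 1) ∧ z = x (j + 2) := by
      rintro j g y z rfl hg hgF hne
      obtain rfl | rfl := h.eq_of_mem hF hf hgF (by rw [hg]; exact Sym2.mem_mk_left _ _)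
      · exact absurd rfl hne
      · rw [h.link, Sym2.congr_right] at hg
        exact ⟨rfl, hg.symm⟩
    obtain ⟨rfl, h2⟩ := step h1 hb' hb hab
    obtain ⟨rfl, h3⟩ := step h2 hc' hc hbc
    obtain ⟨rfl, h4⟩ := step h3 hd' hd hcd
    refine ⟨?_, i, Or.inl ⟨rfl, rfl, rfl, rfl⟩⟩
    by_contra! hlt
    obtain rfl | rfl : n = 2 ∨ n = 3 := by omega
    · exact h02 (by rw [h0, h2, h.per_x])
    · exact h03 (by rw [h0, h3, h.per_x])
  -- The quad runs against the orientation of the cycle, so it is indexed from its far end.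
  · obtain ⟨j, hj⟩ := h.exists_eq_add (by omega) i 3
    have hj0 := hj 0
    have hj1 := (hj 1).2
    simp only [Nat.add_zero] at hj0 hj1
    rw [hj0.1] at hab ⊢
    rw [hj0.2] at h1
    rw [hj1] at h0
    have step : ∀ {j : ℕ} {g : E} {y z : V}, y = x (j + 1) → ends g = s(y, z) → g ∈ F →
        f (j + 1) ≠ g → g = f j ∧ z = x j := by
      rintro j g y z rfl hg hgF hne
      obtain rfl | rfl := h.eq_of_mem hF hf hgF (by rw [hg]; exact Sym2.mem_mk_left _ _)
      · rw [h.link, Sym2.eq_swap, Sym2.congr_right] at hg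
        exact ⟨rfl, hg.symm⟩
      · exact absurd rfl hne
    obtain ⟨rfl, h2⟩ := step h1 hb' hb hab
    obtain ⟨rfl, h3⟩ := step h2 hc' hc hbc
    obtain ⟨rfl, h4⟩ := step h3 hd' hd hcd
    refine ⟨?_, j, Or.inr ⟨rfl, rfl, rfl, rfl⟩⟩
    by_contra! hlt
    obtain rfl | rfl : n = 2 ∨ n = 3 := by omega
    · exact h02 (by rw [h0, h2, ← h.per_x (j + 2)])
    · exact h03 (by rw [h0, h3, ← h.per_x (j + 1)])

end IsCyc

/-- If every end of an edge of `F` lies on two edges of `F`, then `F` contains a cycle. -/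
theorem exists_isCyc [Fintype V] {ends : E → Sym2 V} (hl : ∀ e, ¬ (ends e).IsDiag) {F : Finset E}
    (hF : ∀ x, (F.filter (x ∈ ends ·)).card ≤ 2) (hne : F.Nonempty)
    (h2 : ∀ f ∈ F, ∀ x ∈ ends f, ∃ g ∈ F, g ≠ f ∧ x ∈ ends g) :
    ∃ n x f, 2 ≤ n ∧ IsCyc ends n x f ∧ ∀ i, f i ∈ F := by
  -- `P k` asserts a path with `k` edges in `F`. A longest path is taken and shown to close up.
  let P : ℕ → Prop := fun k => ∃ (x : ℕ → V) (f : ℕ → E),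
    (∀ i < k, f i ∈ F ∧ ends (f i) = s(x i, x (i + 1))) ∧ ∀ i j, i ≤ k → j ≤ k → x i = x j → i = j
  have P1 : P 1 := by
    obtain ⟨e, he⟩ := hne
    obtain ⟨a, b, hab⟩ : ∃ a b, ends e = s(a, b) := by
      induction h : ends e with | _ a b => exact ⟨a, b, rfl⟩
    have hab' : a ≠ b := by have := hl e; rwa [hab, Sym2.mk_isDiag_iff] at this
    refine ⟨fun i => if i = 0 then a else b, fun _ => e, fun i hi => ?_, fun i j hi hj => ?_⟩
    · obtain rfl : i = 0 := by omega
      simpa using ⟨he, hab⟩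
    · obtain rfl | rfl : i = 0 ∨ i = 1 := by omega
      all_goals obtain rfl | rfl : j = 0 ∨ j = 1 := by omega
      all_goals simp [hab', hab'.symm]
  have Pb : ∀ k, P k → k ≤ Fintype.card V := by
    rintro k ⟨x, f, -, hx⟩
    have := Fintype.card_le_of_injective (fun i : Fin (k + 1) => x i) fun i j hij =>
      Fin.ext (hx i j (by omega) (by omega) hij)
    simp only [Fintype.card_fin] at this
    omega
  let k := Nat.findGreatest P (Fintype.card V)
  have hk : P k := Nat.findGreatest_spec (Pb 1 P1) P1
  have hk1 : 1 ≤ k := Nat.le_findGreatest (Pb 1 P1) P1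
  have hmax : ¬ P (k + 1) := fun h => by
    have := Nat.le_findGreatest (Pb _ h) h
    change k + 1 ≤ k at this
    omega
  clear_value k
  obtain ⟨x, f, hf, hx⟩ := hk
  obtain ⟨g, hg, hgf, hxg⟩ := h2 (f (k - 1)) (hf _ (by omega)).1 (x k) (by
    rw [(hf (k - 1) (by omega)).2, show k - 1 + 1 = k by omega]; exact Sym2.mem_mk_right _ _)
  obtain ⟨y, hy⟩ := Sym2.mem_iff_exists.mp hxg
  have hxy : x k ≠ y := by have := hl g; rwa [hy, Sym2.mk_isDiag_iff] at this
  have hfne : ∀ i, i + 1 < k → f i ≠ f (i + 1) := by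
    intro i hi he
    have h1 := (hf i (by omega)).2
    rw [he, (hf (i + 1) hi).2, Sym2.eq_iff] at h1
    rcases h1 with h1 | h1
    · exact absurd (hx _ _ (by omega) (by omega) h1.1) (by omega)
    · exact absurd (hx _ _ (by omega) (by omega) h1.2) (by omega)
  -- The second edge `g` at the last vertex must return to the start: a new vertex would give a
  -- longer path, and an inner vertex already has its two edges on the path.
  have hy' : y = x 0 := by
    by_contra hy0
    by_cases hyj : ∃ j ≤ k, y = x j
    · obtain ⟨j, hj, rfl⟩ := hyj
      have hj0 : j ≠ 0 := fun h => hy0 (h ▸ rfl)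
      have hjk : j ≠ k := fun h => hxy (h ▸ rfl)
      have hm1 := (hf (j - 1) (by omega)).2
      rw [show j - 1 + 1 = j by omega] at hm1
      have hm2 := (hf j (by omega)).2
      rcases eq_or_eq_of_card_le_two (x := x j) hF (hf (j - 1) (by omega)).1
        (hf j (by omega)).1 hg (by rw [hm1]; simp) (by rw [hm2]; simp) (by rw [hy]; simp)
        (by have := hfne (j - 1) (by omega); rwa [show j - 1 + 1 = j by omega] at this)
        with rfl | rfl
      · rw [hy, Sym2.congr_left] at hm1
        exact absurd (hx _ _ (by omega) (by omega) hm1) (by omega)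
      · rw [hy, Sym2.eq_swap, Sym2.congr_right] at hm2
        have := hx _ _ (by omega) (by omega) hm2
        exact hgf (by congr 1; omega)
    · push Not at hyj
      refine hmax ⟨fun i => if i = k + 1 then y else x i, fun i => if i = k then g else f i, ?_, ?_⟩
      · intro i hi
        by_cases hik : i = k
        · subst hik; simpa using ⟨hg, hy⟩
        · simpa [hik, show i ≠ k + 1 by omega] using hf i (by omega)
      · intro i j hi hj
        by_cases hik : i = k + 1 <;> by_cases hjk : j = k + 1
        · simp [hik, hjk]
        · simpa [hik, hjk] using fun h => absurd h (hyj j (by omega))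
        · simpa [hik, hjk] using fun h => absurd h.symm (hyj i (by omega))
        · simpa [hik, hjk] using hx i j (by omega) (by omega)
  subst hy'
  have hmod : ∀ i, i % (k + 1) < k + 1 := fun i => Nat.mod_lt _ (by omega)
  have hmod1 : ∀ i, (i + 1) % (k + 1) = if i % (k + 1) = k then 0 else i % (k + 1) + 1 := by
    intro i
    have := hmod i
    rw [Nat.add_mod, Nat.mod_eq_of_lt (show 1 < k + 1 by omega)]
    split_ifs with h
    · rw [h, Nat.mod_self]
    · exact Nat.mod_eq_of_lt (by omega)
  refine ⟨k + 1, fun i => x (i % (k + 1)), fun i => if i % (k + 1) = k then g else f (i % (k + 1)),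
    by omega, ⟨by simp, by simp, ?_, ?_, ?_⟩, ?_⟩
  · intro i
    simp only [hmod1]
    have := hmod i
    split_ifs with h
    · rw [h, hy]
    · exact (hf _ (by omega)).2
  · intro i j hi hj
    simp only [Nat.mod_eq_of_lt hi, Nat.mod_eq_of_lt hj]
    exact hx i j (by omega) (by omega)
  · intro i
    simp only [hmod1]
    have := hmod i
    generalize i % (k + 1) = i at *
    by_cases h : i = k
    · simp only [h, if_true, show 0 ≠ k by omega, if_false]
      intro he
      have h0 := (hf 0 (by omega)).2
      rw [← he, hy, Sym2.eq_swap, Sym2.congr_right] at h0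
      have := hx _ _ (by omega) (by omega) h0
      exact hgf (by rw [he, this])
    · simp only [h, if_false]
      split_ifs with h'
      · rw [show i = k - 1 by omega]; exact hgf.symm
      · exact hfne i (by omega)
  · intro i
    have := hmod i
    dsimp only
    split_ifs with h
    · exact hg
    · exact (hf _ (by omega)).1

theorem ne_of_ends {ends : E → Sym2 V} {x y z w : V} {a b : E} (ha : ends a = s(x, y))
    (hb : ends b = s(z, w)) (h1 : x ≠ z) (h2 : x ≠ w) : a ≠ b := by
  rintro rfl
  rw [ha, Sym2.eq_iff] at hb
  tauto

theorem touch_of_ends {ends : E → Sym2 V} {x y z : V} {a b : E} (ha : ends a = s(x, y))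
    (hb : ends b = s(y, z)) : Touch ends a b :=
  ⟨y, by simp [ha], by simp [hb]⟩

theorem IsQuad.facts {ends : E → Sym2 V} {a b c d : E} (h : IsQuad ends a b c d) :
    (a ≠ b ∧ b ≠ c ∧ c ≠ d) ∧ (a ≠ c ∧ b ≠ d) ∧
      Touch ends a b ∧ Touch ends b c ∧ Touch ends c d := by
  obtain ⟨x₀, x₁, x₂, x₃, x₄, ha, hb, hc, hd, h01, h02, h03, h12, h13, h14, h23, h24, h34⟩ := h
  exact ⟨⟨ne_of_ends ha hb h01 h02, ne_of_ends hb hc h12 h13, ne_of_ends hc hd h23 h24⟩,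
    ⟨ne_of_ends ha hc h02 h03, ne_of_ends hb hd h13 h14⟩,
    touch_of_ends ha hb, touch_of_ends hb hc, touch_of_ends hc hd⟩

theorem IsQuad.leaf_left {ends : E → Sym2 V} {a b c d : E} (h : IsQuad ends a b c d) {x : V}
    (hx : x ∈ ends b) : x ∈ ends a ∨ x ∈ ends c := by
  obtain ⟨x₀, x₁, x₂, x₃, x₄, ha, hb, hc, hd, -⟩ := h
  rw [hb, Sym2.mem_iff] at hx
  rcases hx with rfl | rfl
  · exact Or.inl (by simp [ha])
  · exact Or.inr (by simp [hc])

/-- At most two edges of `F` are reached in two steps from an edge `f` one of whose ends is not on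
other edges of `F`. -/
theorem card_second_neighbors_le {ends : E → Sym2 V} {F : Finset E}
    (hF : ∀ x, (F.filter (x ∈ ends ·)).card ≤ 2) {f : E} (hf : f ∈ F) {x : V} (hx : x ∈ ends f)
    (hleaf : ∀ g ∈ F, x ∈ ends g → g = f) :
    ((F.erase f).filter fun h => ∃ g ∈ F.erase f, Touch ends f g ∧ Touch ends h g).card ≤ 2 := by
  obtain ⟨y, hy⟩ := Sym2.mem_iff_exists.mp hx
  have hyf : y ∈ ends f := by simp [hy]
  have at_y : ∀ g ∈ F.erase f, Touch ends f g → y ∈ ends g := by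
    rintro g hg ⟨z, hz, hzg⟩
    rw [Finset.mem_erase] at hg
    rw [hy, Sym2.mem_iff] at hz
    rcases hz with rfl | rfl
    · exact absurd (hleaf g hg.2 hzg) hg.1
    · exact hzg
  by_cases hex : ∃ g ∈ F.erase f, Touch ends f g
  · obtain ⟨g, hg, hfg⟩ := hex
    have hyg := at_y g hg hfg
    obtain ⟨z, hz⟩ := Sym2.mem_iff_exists.mp hyg
    refine (Finset.card_le_card fun h hh => ?_).trans (hF z)
    simp only [Finset.mem_filter, Finset.mem_erase] at hh hg ⊢
    obtain ⟨⟨hhf, hhF⟩, g', ⟨hg', hg'F⟩, hfg', w, hwh, hwg'⟩ := hh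
    refine ⟨hhF, ?_⟩
    have uniq : ∀ g' ∈ F, g' ≠ f → y ∈ ends g' → g' = g := fun g' h1 h2 h3 =>
      (eq_or_eq_of_card_le_two hF hf hg.2 h1 hyf hyg h3 hg.1.symm).resolve_left h2
    obtain rfl := uniq g' hg'F hg' (at_y g' (by simp [*]) hfg')
    rw [hz, Sym2.mem_iff] at hwg'
    rcases hwg' with rfl | rfl
    · rw [uniq h hhF hhf hwh, hz]; simp
    · exact hwh
  · rw [Finset.filter_false_of_mem]
    · simp
    · rintro h - ⟨g, hg, hfg, -⟩
      exact hex ⟨g, hg, hfg⟩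

theorem exists_mem_notMem_of_card_lt {s t : Finset C} (h : t.card < s.card) : ∃ z ∈ s, z ∉ t := by
  by_contra! hc
  exact absurd (Finset.card_le_card hc) (not_le.mpr h)

/-- A multigraph of maximum degree two is star edge-colorable from lists of three colors,
unless all edges of a five-cycle have the same list. -/
theorem exists_isStarOn_of_card_le_two [Fintype V] [Nonempty C] {ends : E → Sym2 V}
    (hl : ∀ e, ¬ (ends e).IsDiag) (R : E → Finset C) (F : Finset E)
    (hF : ∀ x, (F.filter (x ∈ ends ·)).card ≤ 2) (hR : ∀ f ∈ F, 3 ≤ (R f).card)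
    (h5 : ∀ x f, IsCyc ends 5 x f → (∀ i, f i ∈ F) →
      ¬ ((∀ i, R (f i) = R (f 0)) ∧ (R (f 0)).card = 3)) :
    ∃ σ : E → C, IsStarOn ends F σ ∧ ∀ f ∈ F, σ f ∈ R f := by
  induction hk : F.card using Nat.strong_induction_on generalizing F with
  | _ k ih =>
  subst hk
  have mono : ∀ F' ⊆ F, F'.card < F.card → ∃ σ : E → C, IsStarOn ends F' σ ∧ ∀ f ∈ F', σ f ∈ R f :=
    fun F' hsub hlt => ih _ hlt F'
      (fun x => (Finset.card_le_card (Finset.filter_subset_filter _ hsub)).trans (hF x))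
      (fun f hf => hR f (hsub hf)) (fun x f hc hf => h5 x f hc fun i => hsub (hf i)) rfl
  rcases F.eq_empty_or_nonempty with rfl | hne
  · exact ⟨fun _ => Classical.arbitrary C, ⟨by simp, by simp⟩, by simp⟩
  -- Without leaves there is a cycle, which is a whole component and is colored separately.
  -- Otherwise a leaf edge is removed and colored last.
  by_cases h2 : ∀ f ∈ F, ∀ x ∈ ends f, ∃ g ∈ F, g ≠ f ∧ x ∈ ends g
  · obtain ⟨n, x, f, hn, hc, hf⟩ := exists_isCyc hl hF hne h2
    let F' := F.filter fun e => ∀ i, e ≠ f i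
    obtain ⟨σ, hσ, hσR⟩ := mono F' (Finset.filter_subset _ _) (Finset.card_lt_card
      (Finset.filter_ssubset.mpr ⟨f 0, hf 0, by push Not; exact ⟨0, rfl⟩⟩))
    have mem' : ∀ e ∈ F, (¬ ∃ i, e = f i) → e ∈ F' := fun e he hne => by
      simpa [F', he] using hne
    obtain ⟨c, hcper, hcR, hcg⟩ := exists_isCyclicGood hn (fun i => R (f i))
      (fun i => by simp only [hc.per_f]) (fun i => hR _ (hf i))
      (by rintro rfl; exact h5 x f hc hf)
    have hcmul : ∀ i k, c (i + k * n) = c i := by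
      intro i k
      induction k with
      | zero => simp
      | succ k ih => rw [Nat.succ_mul, ← Nat.add_assoc, hcper, ih]
    have hcmod : ∀ i, c (i % n) = c i := fun i => by
      conv_rhs => rw [← Nat.mod_add_div i n, Nat.mul_comm, hcmul]
    let τ : E → C := fun e => if h : ∃ i, e = f i then c h.choose else σ e
    have hτc : ∀ i, τ (f i) = c i := by
      intro i
      have h : ∃ j, f i = f j := ⟨i, rfl⟩
      simp only [τ, h, dif_pos]
      rw [← hcmod, ← hcmod i, hc.f_injective hn h.choose_spec]
    have hτσ : ∀ e, (¬ ∃ i, e = f i) → τ e = σ e := fun e he => by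
      simp only [τ, he, dif_neg, not_false_iff]
    have closed : ∀ a ∈ F, ∀ b ∈ F, Touch ends a b → ((∃ i, a = f i) ↔ ∃ i, b = f i) := by
      intro a ha b hb hab
      constructor
      · rintro ⟨i, rfl⟩; exact hc.eq_of_touch (by omega) hF hf hb hab
      · rintro ⟨i, rfl⟩; exact hc.eq_of_touch (by omega) hF hf ha hab.symm
    refine ⟨τ, ⟨?_, ?_⟩, ?_⟩
    · intro a ha b hb hab ht
      have := closed a ha b hb ht
      by_cases h : ∃ i, a = f i
      · obtain ⟨j, hj⟩ := this.mp h
        obtain ⟨i, rfl⟩ := h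
        obtain ⟨y, hy, hyb⟩ := ht
        have key : ∀ j b, b ∈ F → f j ≠ b → x (j + 1) ∈ ends b → τ (f j) ≠ τ b := by
          intro j b hb hne hx
          obtain rfl | rfl := hc.eq_of_mem hF hf hb hx
          · exact absurd rfl hne
          · rw [hτc, hτc]; exact hcg.ne j
        rw [hc.link, Sym2.mem_iff] at hy
        rcases hy with rfl | rfl
        · rw [hj] at hyb hab ⊢
          obtain ⟨l, hl⟩ := hc.exists_eq_add (by omega) i 1
          have hl0 := hl 0
          simp only [Nat.add_zero] at hl0
          rw [hl0.2] at hyb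
          rw [hl0.1] at hab ⊢
          obtain h | h := hc.eq_of_mem hF hf (hf j) hyb
          · rw [h, hτc, hτc]; exact (hcg.ne l).symm
          · exact absurd h.symm hab
        · exact key i b hb hab hyb
      · rw [hτσ a h, hτσ b (fun h' => h (this.mpr h'))]
        exact hσ.ne a (mem' a ha h) b (mem' b hb fun h' => h (this.mpr h')) hab ht
    · intro a ha b hb e he d hd hq
      obtain ⟨-, -, hab, hbe, hed⟩ := hq.facts
      by_cases h : ∃ i, a = f i
      · obtain ⟨h4, j, h | h⟩ := hc.quad_eq hn hF hf h hb he hd hq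
        · obtain ⟨rfl, rfl, rfl, rfl⟩ := h
          simp only [hτc]
          exact hcg.quad h4 j
        · obtain ⟨rfl, rfl, rfl, rfl⟩ := h
          simp only [hτc]
          exact fun h => hcg.quad h4 j ⟨h.2.symm, h.1.symm⟩
      · have h1 := fun h' => h ((closed a ha b hb hab).mpr h')
        have h2 := fun h' => h1 ((closed b hb e he hbe).mpr h')
        have h3 := fun h' => h2 ((closed e he d hd hed).mpr h')
        rw [hτσ a h, hτσ b h1, hτσ e h2, hτσ d h3]
        exact hσ.quad a (mem' a ha h) b (mem' b hb h1) e (mem' e he h2) d (mem' d hd h3) hq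
    · intro e he
      by_cases h : ∃ i, e = f i
      · obtain ⟨i, rfl⟩ := h
        rw [hτc]; exact hcR i
      · rw [hτσ e h]; exact hσR e (mem' e he h)
  · push Not at h2
    obtain ⟨f, hf, x, hx, hleaf⟩ := h2
    have hleaf : ∀ g ∈ F, x ∈ ends g → g = f := fun g hg hxg => by
      by_contra hne
      exact hleaf g hg hne hxg
    -- The leaf edge `f` can only be the first or the last edge of a quad. Hence it is enough that
    -- its color avoid those of the at most two edges within distance two.
    obtain ⟨σ, hσ, hσR⟩ := mono (F.erase f) (Finset.erase_subset _ _)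
      (Finset.card_erase_lt_of_mem hf)
    let N := (F.erase f).filter fun h => ∃ g ∈ F.erase f, Touch ends f g ∧ Touch ends h g
    obtain ⟨z, hzR, hzN⟩ := exists_mem_notMem_of_card_lt (s := R f) (t := N.image σ)
      (Finset.card_image_le.trans_lt ((card_second_neighbors_le hF hf hx hleaf).trans_lt (hR f hf)))
    have hzN : ∀ h ∈ F, h ≠ f → ∀ g ∈ F, g ≠ f → Touch ends f g → Touch ends h g → σ h ≠ z := by
      intro h hh hhf g hg hgf h1 h2 he
      refine hzN (Finset.mem_image.mpr ⟨h, ?_, he⟩)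
      simp only [N, Finset.mem_filter, Finset.mem_erase]
      exact ⟨⟨hhf, hh⟩, g, ⟨hgf, hg⟩, h1, h2⟩
    refine ⟨Function.update σ f z, ⟨?_, ?_⟩, ?_⟩
    · have refl_touch : ∀ a : E, Touch ends a a := fun a => by
        obtain ⟨y, hy⟩ : ∃ y, y ∈ ends a := by
          induction ends a with | _ y => exact ⟨y, by simp⟩
        exact ⟨y, hy, hy⟩
      intro a ha b hb hab ht
      by_cases haf : a = f
      · subst haf
        rw [Function.update_self, Function.update_of_ne hab.symm]
        exact (hzN b hb hab.symm b hb hab.symm ht (refl_touch b)).symm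
      by_cases hbf : b = f
      · subst hbf
        rw [Function.update_self, Function.update_of_ne hab]
        exact hzN a ha hab a ha hab ht.symm (refl_touch a)
      rw [Function.update_of_ne haf, Function.update_of_ne hbf]
      exact hσ.ne a (by simp [*]) b (by simp [*]) hab ht
    · have first : ∀ a ∈ F, ∀ b ∈ F, ∀ c ∈ F, ∀ d, IsQuad ends a b c d → a = f →
          Function.update σ f z a ≠ Function.update σ f z c := by
        rintro a ha b hb c hc d hq rfl
        obtain ⟨⟨h1, -, -⟩, ⟨h2, -⟩, t1, t2, -⟩ := hq.facts
        rw [Function.update_self, Function.update_of_ne h2.symm]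
        exact (hzN c hc h2.symm b hb h1.symm t1 t2.symm).symm
      have second : ∀ a ∈ F, ∀ b ∈ F, ∀ c ∈ F, ∀ d, IsQuad ends a b c d → b ≠ f := by
        rintro a ha b hb c hc d hq rfl
        obtain ⟨⟨h1, h2, -⟩, -⟩ := hq.facts
        rcases hq.leaf_left hx with h | h
        · exact h1 (hleaf a ha h)
        · exact h2 (hleaf c hc h).symm
      rintro a ha b hb c hc d hd hq ⟨e1, e2⟩
      have hbf := second a ha b hb c hc d hq
      have hcf := second d hd c hc b hb a hq.reverse
      by_cases haf : a = f
      · exact first a ha b hb c hc d hq haf e1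
      by_cases hdf : d = f
      · exact first d hd c hc b hb a hq.reverse hdf e2.symm
      rw [Function.update_of_ne haf, Function.update_of_ne hcf] at e1
      rw [Function.update_of_ne hbf, Function.update_of_ne hdf] at e2
      exact hσ.quad a (by simp [*]) b (by simp [*]) c (by simp [*]) d (by simp [*]) hq ⟨e1, e2⟩
    · intro e he
      by_cases hef : e = f
      · subst hef; rwa [Function.update_self]
      · rw [Function.update_of_ne hef]; exact hσR e (by simp [*])

/-! ### Coloring a matching `M` and the remaining edges `F` of maximum degree two. -/

theorem Touch.refl (ends : E → Sym2 V) (a : E) : Touch ends a a := by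
  obtain ⟨y, hy⟩ : ∃ y, y ∈ ends a := by
    induction ends a with | _ y => exact ⟨y, by simp⟩
  exact ⟨y, hy, hy⟩

/-- The edges of `S` at the vertex `x`. -/
noncomputable def edgesAt (ends : E → Sym2 V) (S : Finset E) (x : V) : Finset E :=
  S.filter (x ∈ ends ·)

theorem mem_edgesAt {ends : E → Sym2 V} {S : Finset E} {x : V} {e : E} :
    e ∈ edgesAt ends S x ↔ e ∈ S ∧ x ∈ ends e := Finset.mem_filter

/-- The edges of `M` that touch an edge of `F` touching `f`. -/
noncomputable def window (ends : E → Sym2 V) (M F : Finset E) (f : E) : Finset E :=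
  M.filter fun m => ∃ g ∈ F, Touch ends m g ∧ Touch ends g f

theorem mem_window {ends : E → Sym2 V} {M F : Finset E} {f m : E} :
    m ∈ window ends M F f ↔ m ∈ M ∧ ∃ g ∈ F, Touch ends m g ∧ Touch ends g f := Finset.mem_filter

/-- The colors of the list of `f` not used on its window. -/
noncomputable def residualList (ends : E → Sym2 V) (M F : Finset E) (L : E → Finset C) (σ : E → C)
    (f : E) : Finset C :=
  L f \ (window ends M F f).image σ

/-- The edges `f i` all have the same residual list, and it has three colors. -/
def IsBad (ends : E → Sym2 V) (M F : Finset E) (L : E → Finset C) (σ : E → C) (f : ℕ → E) : Prop :=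
  (∀ i, residualList ends M F L σ (f i) = residualList ends M F L σ (f 0)) ∧
    (residualList ends M F L σ (f 0)).card = 3

section

variable {ends : E → Sym2 V} {M F : Finset E} (hM : ∀ x, (M.filter (x ∈ ends ·)).card ≤ 1)
  (hF : ∀ x, (F.filter (x ∈ ends ·)).card ≤ 2)

include hM

theorem eq_of_mem_matching {x : V} {a b : E} (ha : a ∈ M) (hb : b ∈ M) (xa : x ∈ ends a)
    (xb : x ∈ ends b) : a = b :=
  Finset.card_le_one.mp (hM x) a (by simp [*]) b (by simp [*])

include hF

/-- Each end of `f` contributes at most two edges of `M`: one at this end, and one at the far end of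
the other `F`-edge there. Lists of seven colors therefore keep at least three. -/
theorem card_window_le {f : E} (hf : f ∈ F) : (window ends M F f).card ≤ 4 := by
  let B : V → Finset E := fun x => M.filter fun m =>
    x ∈ ends m ∨ ∃ g ∈ F, g ≠ f ∧ x ∈ ends g ∧ Touch ends m g
  have hB : ∀ x ∈ ends f, (B x).card ≤ 2 := by
    intro x hx
    by_cases hex : ∃ g ∈ F, g ≠ f ∧ x ∈ ends g
    · obtain ⟨g, hg, hgf, hxg⟩ := hex
      obtain ⟨z, hz⟩ := Sym2.mem_iff_exists.mp hxg
      have : B x ⊆ M.filter (x ∈ ends ·) ∪ M.filter (z ∈ ends ·) := by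
        intro m hm
        simp only [B, Finset.mem_filter, Finset.mem_union] at hm ⊢
        rcases hm with ⟨hm, h | ⟨g', hg', hg'f, hxg', w, hw, hwg'⟩⟩
        · exact Or.inl ⟨hm, h⟩
        · obtain rfl := (eq_or_eq_of_card_le_two hF hf hg hg' hx hxg hxg'
            hgf.symm).resolve_left hg'f
          rw [hz, Sym2.mem_iff] at hwg'
          rcases hwg' with rfl | rfl
          · exact Or.inl ⟨hm, hw⟩
          · exact Or.inr ⟨hm, hw⟩
      have h1 := hM x
      have h2 := hM z
      have h3 := (Finset.card_le_card this).trans (Finset.card_union_le _ _)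
      omega
    · refine (Finset.card_le_card fun m hm => ?_).trans ((hM x).trans one_le_two)
      simp only [B, Finset.mem_filter] at hm ⊢
      rcases hm with ⟨hm, h | ⟨g', hg', hg'f, hxg', -⟩⟩
      · exact ⟨hm, h⟩
      · exact absurd ⟨g', hg', hg'f, hxg'⟩ hex
  obtain ⟨x, y, hxy⟩ : ∃ x y, ends f = s(x, y) := by
    induction h : ends f with | _ a b => exact ⟨a, b, rfl⟩
  have hsub : window ends M F f ⊆ B x ∪ B y := by
    intro m hm
    rw [mem_window] at hm
    obtain ⟨hm, g, hg, hmg, w, hwg, hwf⟩ := hm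
    by_cases hgf : g = f
    · subst hgf
      obtain ⟨u, hu, hug⟩ := hmg
      rw [hxy, Sym2.mem_iff] at hug
      rcases hug with rfl | rfl
      · exact Finset.mem_union_left _ (by simp [B, hm, hu])
      · exact Finset.mem_union_right _ (by simp [B, hm, hu])
    · rw [hxy, Sym2.mem_iff] at hwf
      rcases hwf with rfl | rfl
      · exact Finset.mem_union_left _ (Finset.mem_filter.mpr ⟨hm, Or.inr ⟨g, hg, hgf, hwg, hmg⟩⟩)
      · exact Finset.mem_union_right _ (Finset.mem_filter.mpr ⟨hm, Or.inr ⟨g, hg, hgf, hwg, hmg⟩⟩)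
  have h1 := hB x (by simp [hxy])
  have h2 := hB y (by simp [hxy])
  have h3 := (Finset.card_le_card hsub).trans (Finset.card_union_le _ _)
  omega

/-- There are two ends of `m`, at most two `F`-edges at each, and at most one `M`-edge at the far
end of each of these. -/
theorem card_matching_neighbors_le {m : E} (hm : m ∈ M) :
    ((M.erase m).filter fun m' => ∃ g ∈ F, Touch ends m g ∧ Touch ends g m').card ≤ 4 := by
  let B : V → Finset E := fun x => (F.filter (x ∈ ends ·)).biUnion fun g =>
    (M.erase m).filter fun m' => Touch ends g m'
  have hB : ∀ x ∈ ends m, (B x).card ≤ 2 := by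
    intro x hx
    refine (Finset.card_biUnion_le_card_mul _ _ 1 fun g hg => ?_).trans (by simpa using hF x)
    rw [Finset.mem_filter] at hg
    obtain ⟨z, hz⟩ := Sym2.mem_iff_exists.mp hg.2
    refine (Finset.card_le_card fun m' hm' => ?_).trans (hM z)
    simp only [Finset.mem_filter, Finset.mem_erase] at hm' ⊢
    obtain ⟨⟨hne, hm'⟩, w, hw, hwm'⟩ := hm'
    rw [hz, Sym2.mem_iff] at hw
    rcases hw with rfl | rfl
    · exact absurd (eq_of_mem_matching hM hm' hm hwm' hx) hne
    · exact ⟨hm', hwm'⟩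
  obtain ⟨x, y, hxy⟩ : ∃ x y, ends m = s(x, y) := by
    induction h : ends m with | _ a b => exact ⟨a, b, rfl⟩
  have hsub : ((M.erase m).filter fun m' => ∃ g ∈ F, Touch ends m g ∧ Touch ends g m') ⊆
      B x ∪ B y := by
    intro m' hm'
    rw [Finset.mem_filter] at hm'
    obtain ⟨hm', g, hg, ⟨w, hw, hwg⟩, hgm'⟩ := hm'
    rw [hxy, Sym2.mem_iff] at hw
    rcases hw with rfl | rfl
    · exact Finset.mem_union_left _ (Finset.mem_biUnion.mpr
        ⟨g, Finset.mem_filter.mpr ⟨hg, hwg⟩, Finset.mem_filter.mpr ⟨hm', hgm'⟩⟩)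
    · exact Finset.mem_union_right _ (Finset.mem_biUnion.mpr
        ⟨g, Finset.mem_filter.mpr ⟨hg, hwg⟩, Finset.mem_filter.mpr ⟨hm', hgm'⟩⟩)
  have h1 := hB x (by simp [hxy])
  have h2 := hB y (by simp [hxy])
  have h3 := (Finset.card_le_card hsub).trans (Finset.card_union_le _ _)
  omega

-- On a cycle, only the four vertices of the three consecutive edges centered at `f (i + 1)` matter.
omit hM in
theorem window_subset_of_isCyc {n : ℕ} {x : ℕ → V} {f : ℕ → E} (hc : IsCyc ends n x f)
    (hf : ∀ i, f i ∈ F) (i : ℕ) : window ends M F (f (i + 1)) ⊆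
      (edgesAt ends M (x i) ∪ edgesAt ends M (x (i + 1))) ∪
        (edgesAt ends M (x (i + 2)) ∪ edgesAt ends M (x (i + 3))) := by
  intro m hm
  rw [mem_window] at hm
  obtain ⟨hm, g, hg, ⟨u, hu, hug⟩, w, hwg, hwf⟩ := hm
  simp only [Finset.mem_union, mem_edgesAt]
  have hg' : g = f i ∨ g = f (i + 1) ∨ g = f (i + 2) := by
    rw [hc.link, Sym2.mem_iff] at hwf
    rcases hwf with rfl | rfl
    · rcases hc.eq_of_mem hF hf hg hwg with h | h <;> tauto
    · rcases hc.eq_of_mem hF hf hg hwg with h | h <;> tauto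
  rcases hg' with rfl | rfl | rfl
  all_goals
    rw [hc.link, Sym2.mem_iff] at hug
    rcases hug with rfl | rfl <;> tauto

-- A smaller window leaves at least 7 - 3 = 4 colors, while badness requires exactly three.
omit hM hF in
theorem not_isBad_of_card_window_le_three {L : E → Finset C} {f : ℕ → E} {σ : E → C}
    (hL : ∀ i, 7 ≤ (L (f i)).card)
    (i : ℕ) (hw : (window ends M F (f i)).card ≤ 3) : ¬ IsBad ends M F L σ f := by
  rintro ⟨h1, h2⟩
  rw [← h1 i] at h2
  have h3 := Finset.le_card_sdiff ((window ends M F (f i)).image σ) (L (f i))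
  have h4 := Finset.card_image_le (f := σ) (s := window ends M F (f i))
  have h5 := hL i
  unfold residualList at h2
  omega

theorem not_isBad_of_edgesAt_eq_empty {L : E → Finset C} {n : ℕ} {x : ℕ → V} {f : ℕ → E}
    {σ : E → C} (hL : ∀ i, 7 ≤ (L (f i)).card) (hc : IsCyc ends n x f) (hf : ∀ i, f i ∈ F) {i : ℕ}
    (hi : ∀ m ∈ M, x i ∉ ends m) : ¬ IsBad ends M F L σ f := by
  refine not_isBad_of_card_window_le_three hL (i + 1) ?_
  have h0 : edgesAt ends M (x i) = ∅ := Finset.filter_false_of_mem hi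
  have hsub := window_subset_of_isCyc (M := M) hF hc hf i
  rw [h0, Finset.empty_union] at hsub
  have h1 := (Finset.card_le_card hsub).trans ((Finset.card_union_le _ _).trans
    (Nat.add_le_add_left (Finset.card_union_le _ _) _))
  have h2 : ∀ k, (edgesAt ends M (x k)).card ≤ 1 := fun k => hM _
  have := h2 (i + 1)
  have := h2 (i + 2)
  have := h2 (i + 3)
  omega

/-- The edge `m` serves two of the four vertices governing one window, so this window has at most
three edges. -/
theorem not_isBad_of_chord {L : E → Finset C} {n : ℕ} {x : ℕ → V} {f : ℕ → E}
    {σ : E → C} (hL : ∀ i, 7 ≤ (L (f i)).card) (hc : IsCyc ends n x f) (hf : ∀ i, f i ∈ F) {i j : ℕ}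
    (hij : i < j) (hj : j ≤ i + 3) {m : E} (hm : m ∈ M) (hi : x i ∈ ends m) (hj : x j ∈ ends m) :
    ¬ IsBad ends M F L σ f := by
  refine not_isBad_of_card_window_le_three hL (i + 1) ?_
  have h2 : ∀ k, (edgesAt ends M (x k)).card ≤ 1 := fun k => hM _
  have hat : ∀ k, x k ∈ ends m → edgesAt ends M (x k) ⊆ {m} := by
    intro k hk e he
    rw [mem_edgesAt] at he
    exact Finset.mem_singleton.mpr (eq_of_mem_matching hM he.1 hm he.2 hk)
  have hsub := window_subset_of_isCyc (M := M) hF hc hf i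
  have key : ∀ A B : Finset E, A.card ≤ 1 → B.card ≤ 1 → ∀ W : Finset E, W ⊆ {m} ∪ (A ∪ B) →
      W.card ≤ 3 := by
    intro A B hA hB W hW
    have h1 := (Finset.card_le_card hW).trans ((Finset.card_union_le _ _).trans
      (Nat.add_le_add_left (Finset.card_union_le _ _) _))
    simp only [Finset.card_singleton] at h1
    omega
  have hi' := hat i hi
  have hj' := hat j hj
  obtain rfl | rfl | rfl : j = i + 1 ∨ j = i + 2 ∨ j = i + 3 := by omega
  · refine key _ _ (h2 (i + 2)) (h2 (i + 3)) _ (hsub.trans ?_)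
    grind
  · refine key _ _ (h2 (i + 1)) (h2 (i + 3)) _ (hsub.trans ?_)
    grind
  · refine key _ _ (h2 (i + 1)) (h2 (i + 2)) _ (hsub.trans ?_)
    grind

end

theorem five_cycles_agree_aux {ends : E → Sym2 V} {F : Finset E}
    (hF : ∀ x, (F.filter (x ∈ ends ·)).card ≤ 2) {x x' : ℕ → V} {f f' : ℕ → E}
    (hc : IsCyc ends 5 x f) (hf : ∀ i, f i ∈ F) (hc' : IsCyc ends 5 x' f') (hf' : ∀ i, f' i ∈ F)
    (h0 : x 0 = x' 0) (hf0 : f' 0 = f 0) : f' 2 = f 2 := by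
  have step : ∀ i, x i = x' i → f' i = f i → x (i + 1) = x' (i + 1) ∧ f' (i + 1) = f (i + 1) := by
    intro i hx hfi
    have h1 := hc'.link i
    rw [hfi, hc.link, hx, Sym2.congr_right] at h1
    refine ⟨h1, ?_⟩
    refine (hc.eq_of_mem hF hf (hf' _) (h1 ▸ hc'.mem_left (i + 1))).resolve_left fun h => ?_
    exact hc'.ne i (hfi.trans h.symm)
  obtain ⟨h1, hf1⟩ := step 0 h0 hf0
  exact (step 1 h1 hf1).2

/-- Modulo 5, multiplication by 4 is negation, so this is the traversal in the opposite direction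
from `x 0`. -/
theorem IsCyc.reflect {ends : E → Sym2 V} {x : ℕ → V} {f : ℕ → E} (hc : IsCyc ends 5 x f) :
    IsCyc ends 5 (fun i => x (4 * i)) (fun i => f (4 * i + 4)) where
  per_x i := by
    rw [Nat.mul_add, hc.per_x_mul]
  per_f i := by
    rw [show 4 * (i + 5) + 4 = 4 * i + 4 + 4 * 5 by ring, hc.per_f_mul]
  link i := by
    rw [hc.link, show 4 * i + 4 + 1 = 4 * i + 1 * 5 by ring, hc.per_x_mul, Sym2.eq_swap,
      Nat.mul_add]
  inj i j hi hj h := by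
    have := hc.mod_eq (by omega) h
    omega
  ne i := by
    rw [show 4 * i + 4 = 4 * i + 3 + 1 by ring, show 4 * (i + 1) + 4 = 4 * i + 3 + 1 * 5 by ring,
      hc.per_f_mul]
    exact (hc.ne _).symm

/-- Two five-cycles through a common vertex in a multigraph of maximum degree two are equal up to
reflection. -/
theorem five_cycles_agree {ends : E → Sym2 V} {F : Finset E}
    (hF : ∀ x, (F.filter (x ∈ ends ·)).card ≤ 2) {x x' : ℕ → V} {f f' : ℕ → E}
    (hc : IsCyc ends 5 x f) (hf : ∀ i, f i ∈ F) (hc' : IsCyc ends 5 x' f') (hf' : ∀ i, f' i ∈ F)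
    (h0 : x 0 = x' 0) : f' 2 = f 2 ∧ (f' 0 = f 0 ∨ f' 0 = f 4) := by
  have h5 : x (4 + 1) ∈ ends (f' 0) := by
    rw [show x (4 + 1) = x' 0 from (hc.per_x 0).trans h0]; exact hc'.mem_left 0
  rcases hc.eq_of_mem hF hf (hf' 0) h5 with h | h
  · refine ⟨?_, Or.inr h⟩
    have := five_cycles_agree_aux hF hc.reflect (fun i => hf _) hc' hf' h0 h
    rw [this]
    exact hc.per_f_mul 2 2
  · rw [show f (4 + 1) = f 0 from hc.per_f 0] at h
    exact ⟨five_cycles_agree_aux hF hc hf hc' hf' h0 h, Or.inl h⟩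

theorem residualList_update_of_notMem {ends : E → Sym2 V} {M F : Finset E} {L : E → Finset C}
    {σ : E → C} {m f : E} (hm : m ∉ window ends M F f) (z : C) :
    residualList ends M F L (Function.update σ m z) f = residualList ends M F L σ f := by
  unfold residualList
  congr 1
  refine Finset.image_congr fun e he => Function.update_of_ne ?_ _ _
  rintro rfl
  exact hm he

/-- Recoloring `m` leaves the residual list of `g` fixed, with three colors, while that of `f` is
`Q.erase z` with `4 ≤ Q.card`. Equality of the two forces `z` to be the one color of `Q` outside the
list of `g`. -/
theorem eq_of_residualList_update_eq {ends : E → Sym2 V} {M F : Finset E} {L : E → Finset C}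
    {σ : E → C} {m f g : E} {z z' : C} (hf : m ∈ window ends M F f) (hg : m ∉ window ends M F g)
    (hw : (window ends M F f).card ≤ 4) (hL : 7 ≤ (L f).card)
    (h : residualList ends M F L (Function.update σ m z) f =
      residualList ends M F L (Function.update σ m z) g)
    (h' : residualList ends M F L (Function.update σ m z') f =
      residualList ends M F L (Function.update σ m z') g)
    (h3 : (residualList ends M F L (Function.update σ m z) g).card = 3) : z = z' := by
  rw [residualList_update_of_notMem hg] at h h' h3
  let Q := L f \ ((window ends M F f).erase m).image σ
  have key : ∀ z, residualList ends M F L (Function.update σ m z) f = Q.erase z := by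
    intro z
    ext c
    simp only [residualList, Q, Finset.mem_sdiff, Finset.mem_image, Finset.mem_erase]
    constructor
    · rintro ⟨hc, hn⟩
      refine ⟨fun h => hn ⟨m, hf, by rw [Function.update_self, h]⟩, hc, ?_⟩
      rintro ⟨e, ⟨hem, he⟩, rfl⟩
      exact hn ⟨e, he, Function.update_of_ne hem _ _⟩
    · rintro ⟨hcz, hc, hn⟩
      refine ⟨hc, ?_⟩
      rintro ⟨e, he, hec⟩
      by_cases hem : e = m
      · subst hem; rw [Function.update_self] at hec; exact hcz hec.symm
      · rw [Function.update_of_ne hem] at hec; exact hn ⟨e, ⟨hem, he⟩, hec⟩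
  rw [key] at h h'
  have hQ : 4 ≤ Q.card := by
    have h1 := Finset.le_card_sdiff (((window ends M F f).erase m).image σ) (L f)
    have h2 := Finset.card_image_le (f := σ) (s := (window ends M F f).erase m)
    rw [Finset.card_erase_of_mem hf] at h2
    change 4 ≤ (L f \ _).card
    omega
  have hz : z ∈ Q := by
    by_contra hz
    rw [← h, Finset.erase_eq_of_notMem hz] at h3
    omega
  by_contra hne
  have : z ∈ Q.erase z' := Finset.mem_erase.mpr ⟨hne, hz⟩
  rw [h', ← h] at this
  exact Finset.notMem_erase _ _ this

theorem IsBad.shift {ends : E → Sym2 V} {M F : Finset E} {L : E → Finset C} {σ : E → C}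
    {f : ℕ → E} (h : IsBad ends M F L σ f) (k : ℕ) : IsBad ends M F L σ (fun i => f (i + k)) :=
  ⟨fun i => by simp only [h.1 (i + k), h.1 (0 + k)], by simp only [h.1 (0 + k), h.2]⟩

section

variable {ends : E → Sym2 V} {M F : Finset E} (hM : ∀ x, (M.filter (x ∈ ends ·)).card ≤ 1)
  (hF : ∀ x, (F.filter (x ∈ ends ·)).card ≤ 2)

include hM hF

/-- With the other edges of `M` colored, at most one color of `m` makes the five-cycle of `F`
through a given end of `m` bad. -/
theorem bad_color_unique {L : E → Finset C} (hL : ∀ f ∈ F, 7 ≤ (L f).card) {σ : E → C} {m : E}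
    (hm : m ∈ M) {z z' : C} {x x' : ℕ → V} {f f' : ℕ → E} (hc : IsCyc ends 5 x f)
    (hf : ∀ i, f i ∈ F) (hc' : IsCyc ends 5 x' f') (hf' : ∀ i, f' i ∈ F) (hxm : x 0 ∈ ends m)
    (hx : x 0 = x' 0) (hb : IsBad ends M F L (Function.update σ m z) f)
    (hb' : IsBad ends M F L (Function.update σ m z') f') : z = z' := by
  obtain ⟨h2, h0⟩ := five_cycles_agree hF hc hf hc' hf' hx
  have hx5 : x 5 ∈ ends m := by rw [show x 5 = x 0 from hc.per_x 0]; exact hxm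
  have hm0 : m ∈ window ends M F (f 0) :=
    mem_window.mpr ⟨hm, f 0, hf 0, ⟨x 0, hxm, hc.mem_left 0⟩, Touch.refl _ _⟩
  have hm4 : m ∈ window ends M F (f 4) :=
    mem_window.mpr ⟨hm, f 4, hf 4, ⟨x 5, hx5, hc.mem_right 4⟩, Touch.refl _ _⟩
  -- The edge `f 2` lies opposite `x 0`. Its window is governed by the other four vertices, so `m`
  -- could belong to it only as a chord, and a chord excludes badness.
  have hm2 : m ∉ window ends M F (f 2) := by
    intro hm2
    have := window_subset_of_isCyc (M := M) hF hc hf 1 hm2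
    simp only [Finset.mem_union, mem_edgesAt] at this
    have hL' := fun i => hL _ (hf i)
    rcases this with (⟨-, h⟩ | ⟨-, h⟩) | (⟨-, h⟩ | ⟨-, h⟩)
    · exact not_isBad_of_chord hM hF hL' hc hf (show 0 < 1 by omega) (by omega) hm hxm h hb
    · exact not_isBad_of_chord hM hF hL' hc hf (show 0 < 2 by omega) (by omega) hm hxm h hb
    · exact not_isBad_of_chord hM hF hL' hc hf (show 0 < 3 by omega) (by omega) hm hxm h hb
    · exact not_isBad_of_chord hM hF hL' hc hf (show 4 < 5 by omega) (by omega) hm h hx5 hb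
  have e2 := hb.1 2
  have c2 : (residualList ends M F L (Function.update σ m z) (f 2)).card = 3 := by rw [e2, hb.2]
  have e2' := hb'.1 2
  rw [h2] at e2'
  rcases h0 with h0 | h0
  · exact eq_of_residualList_update_eq hm0 hm2 (card_window_le hM hF (hf 0)) (hL _ (hf 0)) e2.symm
      (by rw [← h0, e2']) c2
  · exact eq_of_residualList_update_eq hm4 hm2 (card_window_le hM hF (hf 4)) (hL _ (hf 4))
      (by rw [hb.1 4, e2]) (by rw [← h0, e2']) c2

/-- The edges of a matching `M` can be colored from lists of seven colors such that those joined by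
an edge of `F` have different colors and the residual lists on no five-cycle of `F` coincide. -/
theorem exists_matching_coloring {L : E → Finset C} {P : Finset E} (hPM : P ⊆ M)
    (hP : P.card ≤ 1) (hL : ∀ e ∈ (M ∪ F) \ P, 7 ≤ (L e).card) (hFP : Disjoint F P) (σ₀ : E → C) :
    ∃ σ : E → C, (∀ e ∈ P, σ e = σ₀ e) ∧ (∀ e ∈ M \ P, σ e ∈ L e) ∧
      (∀ m ∈ M, ∀ m' ∈ M, m ≠ m' → ∀ g ∈ F, Touch ends m g → Touch ends g m' → σ m ≠ σ m') ∧
      ∀ x f, IsCyc ends 5 x f → (∀ i, f i ∈ F) → ¬ IsBad ends M F L σ f := by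
  have hLF : ∀ f ∈ F, 7 ≤ (L f).card := fun f hf => hL f (by
    simp [hf, Finset.disjoint_left.mp hFP hf])
  -- Edges of `M` are colored one at a time. A five-cycle is only required to be good once all its
  -- vertices are covered by colored edges of `M`.
  have main : ∀ Q, Q ⊆ M → ∃ σ : E → C, (∀ e ∈ P, σ e = σ₀ e) ∧ (∀ e ∈ Q \ P, σ e ∈ L e) ∧
      (∀ m ∈ P ∪ Q, ∀ m' ∈ P ∪ Q, m ≠ m' → ∀ g ∈ F, Touch ends m g → Touch ends g m' →
        σ m ≠ σ m') ∧
      ∀ x f, IsCyc ends 5 x f → (∀ i, f i ∈ F) → (∀ i, ∃ m ∈ P ∪ Q, x i ∈ ends m) →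
        ¬ IsBad ends M F L σ f := by
    intro Q
    induction Q using Finset.induction_on with
    | empty =>
      intro _
      refine ⟨σ₀, fun _ _ => rfl, by simp, ?_, ?_⟩
      · intro m hm m' hm' hne
        rw [Finset.union_empty] at hm hm'
        exact absurd (Finset.card_le_one.mp hP m hm m' hm') hne
      · intro x f hc hf hcov
        rw [Finset.union_empty] at hcov
        -- A single edge covering two consecutive vertices of the cycle is a chord.
        obtain ⟨m, hm, h0⟩ := hcov 0
        obtain ⟨m', hm', h1⟩ := hcov 1
        obtain rfl := Finset.card_le_one.mp hP m hm m' hm'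
        exact not_isBad_of_chord hM hF (fun i => hLF _ (hf i)) hc hf (show 0 < 1 by omega)
          (by omega) (hPM hm) h0 h1
    | insert m Q hmQ ih =>
      intro hQM
      obtain ⟨σ, hσP, hσL, hσN, hσ5⟩ := ih ((Finset.subset_insert _ _).trans hQM)
      have hm : m ∈ M := hQM (Finset.mem_insert_self _ _)
      by_cases hmP : m ∈ P
      · have h1 : P ∪ insert m Q = P ∪ Q := by
          ext e; simp only [Finset.mem_union, Finset.mem_insert]
          constructor
          · rintro (h | rfl | h) <;> tauto
          · tauto
        have h2 : insert m Q \ P = Q \ P := Finset.insert_sdiff_of_mem _ hmP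
        rw [h1, h2]
        exact ⟨σ, hσP, hσL, hσN, hσ5⟩
      have bad : ∀ v ∈ ends m, ∃ z₀ : C, ∀ z x f, IsCyc ends 5 x f → (∀ i, f i ∈ F) → x 0 = v →
          IsBad ends M F L (Function.update σ m z) f → z = z₀ := by
        intro v hv
        by_cases hex : ∃ z x f, IsCyc ends 5 x f ∧ (∀ i, f i ∈ F) ∧ x 0 = v ∧
            IsBad ends M F L (Function.update σ m z) f
        · obtain ⟨z₀, x, f, hc, hf, hx, hb⟩ := hex
          refine ⟨z₀, fun z x' f' hc' hf' hx' hb' => ?_⟩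
          exact bad_color_unique hM hF hLF hm hc' hf' hc hf (hx' ▸ hv) (hx'.trans hx.symm) hb' hb
        -- No color is bad at this end, so `σ m` is an arbitrary default.
        · exact ⟨σ m, fun z x f hc hf hx hb => absurd ⟨z, x, f, hc, hf, hx, hb⟩ hex⟩
      obtain ⟨u, v, huv⟩ : ∃ u v, ends m = s(u, v) := by
        induction h : ends m with | _ a b => exact ⟨a, b, rfl⟩
      obtain ⟨zu, hzu⟩ := bad u (by simp [huv])
      obtain ⟨zv, hzv⟩ := bad v (by simp [huv])
      let N := (M.erase m).filter fun m' => ∃ g ∈ F, Touch ends m g ∧ Touch ends g m'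
      -- Four conflicting edges of `M` and one bad color per end exclude at most six of seven
      -- colors.
      obtain ⟨z, hzL, hz⟩ := exists_mem_notMem_of_card_lt (s := L m) (t := N.image σ ∪ {zu, zv}) (by
        have h1 := card_matching_neighbors_le hM hF hm
        have h2 : (N.image σ).card ≤ N.card := Finset.card_image_le
        have h3 : ({zu, zv} : Finset C).card ≤ 2 := Finset.card_le_two
        have h4 := Finset.card_union_le (N.image σ) {zu, zv}
        have h5 := hL m (by simp [hm, hmP])
        change N.card ≤ 4 at h1
        omega)
      simp only [Finset.mem_union, Finset.mem_insert, Finset.mem_singleton, not_or,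
        Finset.mem_image, not_exists, not_and] at hz
      obtain ⟨hzN, hzu', hzv'⟩ := hz
      have hNmem : ∀ m' ∈ M, m' ≠ m → ∀ g ∈ F, Touch ends m g → Touch ends g m' → σ m' ≠ z := by
        intro m' hm' hne g hg h1 h2
        exact hzN m' (Finset.mem_filter.mpr ⟨Finset.mem_erase.mpr ⟨hne, hm'⟩, g, hg, h1, h2⟩)
      have memM : ∀ e ∈ P ∪ insert m Q, e ∈ M := fun e he => by
        rcases Finset.mem_union.mp he with h | h
        exacts [hPM h, hQM h]
      have mem_old : ∀ e ∈ P ∪ insert m Q, e ≠ m → e ∈ P ∪ Q := fun e he hne => by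
        simp only [Finset.mem_union, Finset.mem_insert] at he ⊢
        tauto
      refine ⟨Function.update σ m z, ?_, ?_, ?_, ?_⟩
      · intro e he
        rw [Function.update_of_ne (by rintro rfl; exact hmP he)]
        exact hσP e he
      · intro e he
        by_cases hem : e = m
        · subst hem; rwa [Function.update_self]
        · rw [Function.update_of_ne hem]
          refine hσL e ?_
          simp only [Finset.mem_sdiff, Finset.mem_insert] at he ⊢
          tauto
      · intro a ha b hb hab g hg hag hgb
        by_cases ham : a = m
        · subst ham
          rw [Function.update_self, Function.update_of_ne hab.symm]
          exact (hNmem b (memM b hb) hab.symm g hg hag hgb).symm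
        by_cases hbm : b = m
        · subst hbm
          rw [Function.update_self, Function.update_of_ne hab]
          exact hNmem a (memM a ha) hab g hg hgb.symm hag.symm
        rw [Function.update_of_ne ham, Function.update_of_ne hbm]
        exact hσN a (mem_old a ha ham) b (mem_old b hb hbm) hab g hg hag hgb
      · intro x f hc hf hcov hbad
        by_cases hex : ∃ i, x i ∈ ends m
        · obtain ⟨i, hi⟩ := hex
          have hc' := hc.shift (by omega) i
          rw [huv, Sym2.mem_iff] at hi
          rcases hi with hi | hi
          · exact hzu' (hzu z _ _ hc' (fun j => hf _) (by simpa using hi) (hbad.shift i))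
          · exact hzv' (hzv z _ _ hc' (fun j => hf _) (by simpa using hi) (hbad.shift i))
        -- A five-cycle avoiding `m` has `m` in none of its windows, so its residual lists have not
        -- changed.
        · push Not at hex
          have hnw : ∀ i, m ∉ window ends M F (f i) := by
            intro i hmi
            obtain ⟨j, hj⟩ := hc.exists_eq_add (by omega) i 1
            have hj0 := (hj 0).1
            simp only [Nat.add_zero] at hj0
            rw [hj0] at hmi
            have := window_subset_of_isCyc hF hc hf j hmi
            simp only [Finset.mem_union, mem_edgesAt, hex, and_false, or_false] at this
          unfold IsBad at hbad
          simp only [residualList_update_of_notMem (hnw _)] at hbad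
          refine hσ5 x f hc hf (fun i => ?_) hbad
          obtain ⟨m', hm', hx⟩ := hcov i
          exact ⟨m', mem_old m' hm' (by rintro rfl; exact hex i hx), hx⟩
  obtain ⟨σ, hσP, hσL, hσN, hσ5⟩ := main M subset_rfl
  rw [Finset.union_eq_right.mpr hPM] at hσN hσ5
  refine ⟨σ, hσP, hσL, hσN, fun x f hc hf => ?_⟩
  -- A vertex that `M` leaves uncovered makes some window too small for badness.
  by_cases hcov : ∀ i, ∃ m ∈ M, x i ∈ ends m
  · exact hσ5 x f hc hf hcov
  · push Not at hcov
    obtain ⟨i, hi⟩ := hcov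
    exact not_isBad_of_edgesAt_eq_empty hM hF (fun i => hLF _ (hf i)) hc hf hi

/-- A multigraph that splits into a matching `M` and a subgraph `F` of maximum degree two is star
edge-colorable from lists of seven colors, even if an edge of `M` is precolored, and such that
the color of an edge of `M` does not occur on the edges at distance at most two from it. -/
theorem exists_isStarOn_union [Fintype V] [Nonempty C] (hl : ∀ e, ¬ (ends e).IsDiag)
    {L : E → Finset C} (hMF : Disjoint M F) {P : Finset E} (hPM : P ⊆ M) (hP : P.card ≤ 1)
    (hL : ∀ e ∈ (M ∪ F) \ P, 7 ≤ (L e).card) (σ₀ : E → C) :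
    ∃ σ : E → C, (∀ e ∈ P, σ e = σ₀ e) ∧ (∀ e ∈ (M ∪ F) \ P, σ e ∈ L e) ∧
      IsStarOn ends (M ∪ F) σ ∧ ∀ m ∈ M, ∀ h ∈ M ∪ F, m ≠ h → ∀ g ∈ M ∪ F, Touch ends m g →
        Touch ends g h → σ m ≠ σ h := by
  have hFP : Disjoint F P := hMF.symm.mono_right hPM
  have hFM : ∀ e ∈ F, e ∉ M := fun e he => Finset.disjoint_right.mp hMF he
  obtain ⟨ρ, hρP, hρL, hρN, hρ5⟩ := exists_matching_coloring hM hF hPM hP hL hFP σ₀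
  have hLF : ∀ f ∈ F, 7 ≤ (L f).card := fun f hf => hL f (by
    simp [hf, Finset.disjoint_left.mp hFP hf])
  obtain ⟨τ, hτ, hτR⟩ := exists_isStarOn_of_card_le_two hl (residualList ends M F L ρ) F hF
    (fun f hf => by
      have h1 := Finset.le_card_sdiff ((window ends M F f).image ρ) (L f)
      have h2 : ((window ends M F f).image ρ).card ≤ _ := Finset.card_image_le
      have h3 := card_window_le hM hF hf
      have h4 := hLF f hf
      change 3 ≤ (L f \ _).card
      omega) hρ5
  let σ : E → C := fun e => if e ∈ M then ρ e else τ e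
  have σM : ∀ e ∈ M, σ e = ρ e := fun e he => if_pos he
  have σF : ∀ e ∈ F, σ e = τ e := fun e he => if_neg (hFM e he)
  have strong : ∀ m ∈ M, ∀ h ∈ M ∪ F, m ≠ h → ∀ g ∈ M ∪ F, Touch ends m g →
        Touch ends g h → σ m ≠ σ h := by
    intro m hm h hh hne g hg hmg hgh
    have touch_M : ∀ b ∈ M, Touch ends m b → m = b := by
      rintro b hb ⟨x, hx, hxb⟩
      exact eq_of_mem_matching hM hm hb hx hxb
    have win : ∀ f ∈ F, m ∈ window ends M F f → σ m ≠ σ f := by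
      intro f hf hw
      rw [σM m hm, σF f hf]
      intro he
      have := hτR f hf
      rw [← he, residualList, Finset.mem_sdiff] at this
      exact this.2 (Finset.mem_image_of_mem _ hw)
    rw [Finset.mem_union] at hg hh
    rcases hg with hg | hg
    · obtain rfl := touch_M g hg hmg
      rcases hh with hh | hh
      · exact absurd (touch_M h hh hgh) hne
      · exact win h hh (mem_window.mpr ⟨hm, h, hh, hgh, Touch.refl _ _⟩)
    · rcases hh with hh | hh
      · rw [σM m hm, σM h hh]; exact hρN m hm h hh hne g hg hmg hgh
      · exact win h hh (mem_window.mpr ⟨hm, g, hg, hmg, hgh⟩)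
  refine ⟨σ, fun e he => (σM e (hPM he)).trans (hρP e he), ?_, ⟨?_, ?_⟩, strong⟩
  · intro e he
    simp only [Finset.mem_sdiff, Finset.mem_union] at he
    rcases he.1 with h | h
    · rw [σM e h]; exact hρL e (Finset.mem_sdiff.mpr ⟨h, he.2⟩)
    · rw [σF e h]; exact Finset.sdiff_subset (hτR e h)
  · intro a ha b hb hab ht
    by_cases haM : a ∈ M
    · exact strong a haM b hb hab b hb ht (Touch.refl _ _)
    by_cases hbM : b ∈ M
    · exact (strong b hbM a ha hab.symm a ha ht.symm (Touch.refl _ _)).symm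
    have ha' := (Finset.mem_union.mp ha).resolve_left haM
    have hb' := (Finset.mem_union.mp hb).resolve_left hbM
    rw [σF a ha', σF b hb']
    exact hτ.ne a ha' b hb' hab ht
  · rintro a ha b hb c hc d hd hq ⟨e1, e2⟩
    obtain ⟨-, ⟨hac, hbd⟩, tab, tbc, tcd⟩ := hq.facts
    have mem : ∀ e ∈ M ∪ F, e ∉ M → e ∈ F := fun e he h => (Finset.mem_union.mp he).resolve_left h
    have ha' := mem a ha fun h => strong a h c hc hac b hb tab tbc e1
    have hc' := mem c hc fun h => strong c h a ha hac.symm b hb tbc.symm tab.symm e1.symm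
    have hb' := mem b hb fun h => strong b h d hd hbd c hc tbc tcd e2
    have hd' := mem d hd fun h => strong d h b hb hbd.symm c hc tcd.symm tbc.symm e2.symm
    rw [σF a ha', σF c hc'] at e1
    rw [σF b hb', σF d hd'] at e2
    exact hτ.quad a ha' b hb' c hc' d hd' hq ⟨e1, e2⟩

end

/-! ### Edge cuts and a matching from Tutte's theorem. -/

/-- The edges of `D` with exactly one end in `Z`. -/
noncomputable def cutEdges (ends : E → Sym2 V) (D : Finset E) (Z : Finset V) : Finset E :=
  D.filter fun e => (∃ x ∈ Z, x ∈ ends e) ∧ ∃ y ∉ Z, y ∈ ends e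

/-- The edges of `D` with both ends in `Z`. -/
noncomputable def insideEdges (ends : E → Sym2 V) (D : Finset E) (Z : Finset V) : Finset E :=
  D.filter fun e => ∀ x ∈ ends e, x ∈ Z

theorem mem_cutEdges {ends : E → Sym2 V} {D : Finset E} {Z : Finset V} {e : E} :
    e ∈ cutEdges ends D Z ↔ e ∈ D ∧ (∃ x ∈ Z, x ∈ ends e) ∧ ∃ y ∉ Z, y ∈ ends e :=
  Finset.mem_filter

theorem mem_insideEdges {ends : E → Sym2 V} {D : Finset E} {Z : Finset V} {e : E} :
    e ∈ insideEdges ends D Z ↔ e ∈ D ∧ ∀ x ∈ ends e, x ∈ Z := Finset.mem_filter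

theorem insideEdges_subset (ends : E → Sym2 V) (D : Finset E) (Z : Finset V) :
    insideEdges ends D Z ⊆ D := Finset.filter_subset _ _

theorem cutEdges_subset (ends : E → Sym2 V) (D : Finset E) (Z : Finset V) :
    cutEdges ends D Z ⊆ D := Finset.filter_subset _ _

/-- Count incidences: 3|Z| is the sum over the edges of their numbers of ends in `Z`, and the odd
terms are those of the cut edges. -/
theorem odd_card_cutEdges {ends : E → Sym2 V} (hl : ∀ e, ¬ (ends e).IsDiag) {D : Finset E}
    {Z : Finset V} (h3 : ∀ x ∈ Z, (D.filter (x ∈ ends ·)).card = 3) (hodd : Odd Z.card) :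
    Odd (cutEdges ends D Z).card := by
  have hsum : ∑ x ∈ Z, (D.filter (x ∈ ends ·)).card = ∑ e ∈ D, (Z.filter (· ∈ ends e)).card :=
    Finset.sum_card_bipartiteAbove_eq_sum_card_bipartiteBelow fun x e => x ∈ ends e
  rw [Finset.sum_congr rfl h3, Finset.sum_const, smul_eq_mul] at hsum
  have h1 : Odd (∑ e ∈ D, (Z.filter (· ∈ ends e)).card) := hsum ▸ hodd.mul (by decide)
  rw [Finset.odd_sum_iff_odd_card_odd] at h1
  convert h1 using 2
  unfold cutEdges
  refine Finset.filter_congr fun e _ => ?_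
  obtain ⟨a, b, hab⟩ : ∃ a b, ends e = s(a, b) := by
    induction h : ends e with | _ a b => exact ⟨a, b, rfl⟩
  have hne : a ≠ b := by have := hl e; rwa [hab, Sym2.mk_isDiag_iff] at this
  have hfil : Z.filter (· ∈ ends e) = Z ∩ {a, b} := by
    ext x; simp [hab]
  rw [hfil, hab]
  by_cases ha : a ∈ Z <;> by_cases hb : b ∈ Z
  · rw [Finset.inter_eq_right.mpr (by grind), Finset.card_pair hne]
    simp only [Sym2.mem_iff]
    refine iff_of_false ?_ (by decide)
    rintro ⟨-, y, hy, rfl | rfl⟩ <;> contradiction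
  · rw [show Z ∩ {a, b} = {a} by grind, Finset.card_singleton]
    exact iff_of_true ⟨⟨a, ha, by simp⟩, b, hb, by simp⟩ odd_one
  · rw [show Z ∩ {a, b} = {b} by grind, Finset.card_singleton]
    exact iff_of_true ⟨⟨b, hb, by simp⟩, a, ha, by simp⟩ odd_one
  · rw [show Z ∩ {a, b} = ∅ by grind, Finset.card_empty]
    simp only [Sym2.mem_iff]
    refine iff_of_false ?_ (by decide)
    rintro ⟨⟨y, hy, rfl | rfl⟩, -⟩ <;> contradiction

section

variable {ends : E → Sym2 V} (hl : ∀ e, ¬ (ends e).IsDiag) {D : Finset E}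
  (hdeg : ∀ x, (D.filter (x ∈ ends ·)).card ≤ 3) {Y : Finset V}
  (hY : (cutEdges ends D Y).card ≤ 1)
  (hmin : ∀ Z ⊂ Y, Z.Nonempty → 2 ≤ (cutEdges ends D Z).card)

include hl hdeg hY hmin

/-- The Tutte condition for the cubic vertices of `Y` not incident with the boundary of `Y`. -/
theorem card_odd_sets_le {ι : Type*} (O : Finset ι) (Z : ι → Finset V) (U : Finset V)
    (hZY : ∀ i ∈ O, Z i ⊆ Y) (hZB : ∀ i ∈ O, ∀ x ∈ Z i, ∀ e ∈ cutEdges ends D Y, x ∉ ends e)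
    (h3 : ∀ i ∈ O, ∀ x ∈ Z i, (D.filter (x ∈ ends ·)).card = 3)
    (hodd : ∀ i ∈ O, Odd (Z i).card) (hdisj : ∀ i ∈ O, ∀ j ∈ O, ∀ x ∈ Z i, x ∈ Z j → i = j)
    (hU : ∀ i ∈ O, ∀ x ∈ Z i, x ∉ U)
    (hclosed : ∀ i ∈ O, ∀ a ∈ Z i, ∀ e ∈ D, ∀ b ∈ Y, ends e = s(a, b) →
      (∀ e ∈ cutEdges ends D Y, b ∉ ends e) → b ∈ Z i ∨ b ∈ U) :
    O.card ≤ U.card := by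
  -- Minimality of `Y` gives two cut edges, and parity a third. The case `Z i = Y` is impossible,
  -- since its odd cut would be nonempty and `Z i` avoids the ends of the cut of `Y`.
  have hbd3 : ∀ i ∈ O, 3 ≤ (cutEdges ends D (Z i)).card := by
    intro i hi
    have ho := odd_card_cutEdges hl (h3 i hi) (hodd i hi)
    have hne : (Z i).Nonempty := Finset.card_pos.mp (hodd i hi).pos
    rcases (hZY i hi).eq_or_ssubset with heq | hss
    · exfalso
      obtain ⟨e, he⟩ := Finset.card_pos.mp ho.pos
      obtain ⟨x, hx, hxe⟩ := (mem_cutEdges.mp he).2.1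
      exact hZB i hi x hx e (heq ▸ he) hxe
    · have := hmin _ hss hne
      obtain ⟨k, hk⟩ := ho
      omega
  -- `S` collects the edges of `Y` next to its cut edge, at most two by the degree bound. Every edge
  -- leaving some `Z i` ends in `U` or belongs to `S`.
  let S : Finset E := (insideEdges ends D Y).filter fun e => ∃ g ∈ cutEdges ends D Y, Touch ends e g
  have hS : S.card ≤ 2 := by
    rcases (cutEdges ends D Y).eq_empty_or_nonempty with h0 | ⟨g, hg⟩
    · have : S = ∅ := Finset.filter_false_of_mem (by simp [h0])
      simp [this]
    · have hg' := mem_cutEdges.mp hg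
      obtain ⟨hgD, ⟨v, hv, hvg⟩, w, hw, hwg⟩ := hg'
      have hsub : S ⊆ (D.filter (v ∈ ends ·)).erase g := by
        intro e he
        obtain ⟨he, g', hg', y, hye, hyg'⟩ := Finset.mem_filter.mp he
        obtain rfl := Finset.card_le_one.mp hY g hg g' hg'
        rw [mem_insideEdges] at he
        have hyv : y = v := by
          obtain ⟨z, hz⟩ := Sym2.mem_iff_exists.mp hvg
          have hwz : w = z := by
            rw [hz, Sym2.mem_iff] at hwg
            rcases hwg with rfl | rfl
            · exact absurd hv hw
            · rfl
          rw [hz, Sym2.mem_iff] at hyg'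
          rcases hyg' with rfl | rfl
          · rfl
          · exact absurd (he.2 _ hye) (hwz ▸ hw)
        subst hyv
        refine Finset.mem_erase.mpr ⟨?_, Finset.mem_filter.mpr ⟨he.1, hye⟩⟩
        rintro rfl
        exact hw (he.2 w hwg)
      have h1 := Finset.card_le_card hsub
      rw [Finset.card_erase_of_mem (Finset.mem_filter.mpr ⟨hgD, hvg⟩)] at h1
      have := hdeg v
      omega
  have other : ∀ i ∈ O, ∀ e ∈ cutEdges ends D (Z i), ∃ a ∈ Z i, ∃ b, ends e = s(a, b) ∧
      (b ∈ U ∨ (e ∈ S ∧ ∃ g ∈ cutEdges ends D Y, b ∈ ends g)) := by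
    intro i hi e he
    obtain ⟨heD, ⟨a, ha, hae⟩, b, hb, hbe⟩ := mem_cutEdges.mp he
    have hab : a ≠ b := by rintro rfl; exact hb ha
    have hends : ends e = s(a, b) := (Sym2.mem_and_mem_iff hab).mp ⟨hae, hbe⟩
    refine ⟨a, ha, b, hends, ?_⟩
    have hbY : b ∈ Y := by
      by_contra hbY
      exact hZB i hi a ha e (mem_cutEdges.mpr ⟨heD, ⟨a, hZY i hi ha, hae⟩, b, hbY, hbe⟩) hae
    by_cases hg : ∃ g ∈ cutEdges ends D Y, b ∈ ends g
    · obtain ⟨g, hg, hbg⟩ := hg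
      refine Or.inr ⟨Finset.mem_filter.mpr ⟨mem_insideEdges.mpr ⟨heD, ?_⟩, g, hg, b, hbe, hbg⟩,
        g, hg, hbg⟩
      intro x hx
      rw [hends, Sym2.mem_iff] at hx
      rcases hx with rfl | rfl
      exacts [hZY i hi ha, hbY]
    · push Not at hg
      exact Or.inl ((hclosed i hi a ha e heD b hbY hends hg).resolve_left hb)
  have hpw : ∀ i ∈ O, ∀ j ∈ O, i ≠ j →
      Disjoint (cutEdges ends D (Z i)) (cutEdges ends D (Z j)) := by
    intro i hi j hj hij
    rw [Finset.disjoint_left]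
    intro e hei hej
    obtain ⟨a, ha, b, hab, hb⟩ := other i hi e hei
    obtain ⟨-, ⟨a', ha', hae'⟩, -⟩ := mem_cutEdges.mp hej
    rw [hab, Sym2.mem_iff] at hae'
    rcases hae' with rfl | rfl
    · exact hij (hdisj i hi j hj _ ha ha')
    · rcases hb with hb | ⟨-, g, hg, hbg⟩
      · exact hU j hj _ ha' hb
      · exact hZB j hj _ ha' g hg hbg
  -- The cuts are disjoint, so 3|O| ≤ 3|U| + 2 and hence |O| ≤ |U|.
  have hle : (O.biUnion fun i => cutEdges ends D (Z i)).card ≤ U.card * 3 + 2 := by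
    have hsub : (O.biUnion fun i => cutEdges ends D (Z i)) ⊆
        (U.biUnion fun x => D.filter (x ∈ ends ·)) ∪ S := by
      intro e he
      obtain ⟨i, hi, he⟩ := Finset.mem_biUnion.mp he
      obtain ⟨a, ha, b, hab, hb⟩ := other i hi e he
      rcases hb with hb | ⟨hb, -⟩
      · exact Finset.mem_union_left _ (Finset.mem_biUnion.mpr ⟨b, hb, Finset.mem_filter.mpr
          ⟨(mem_cutEdges.mp he).1, by simp [hab]⟩⟩)
      · exact Finset.mem_union_right _ hb
    have h1 := (Finset.card_le_card hsub).trans (Finset.card_union_le _ _)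
    have h2 := Finset.card_biUnion_le_card_mul U (fun x => D.filter (x ∈ ends ·)) 3
      fun x _ => hdeg x
    omega
  rw [Finset.card_biUnion hpw] at hle
  have := Finset.card_nsmul_le_sum O _ 3 hbd3
  rw [smul_eq_mul] at this
  omega

/-- The cut edge is put into `M`, which settles its ends. What remains is a matching inside `A`,
away from the cut edge, that covers the set `T` of cubic vertices. Tutte's theorem speaks of perfect
matchings, so it is applied to an auxiliary graph in which the vertices outside `T` may be matched
at will. -/
theorem exists_matching_covering [Fintype V] : ∃ M ⊆ insideEdges ends D Y ∪ cutEdges ends D Y,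
    cutEdges ends D Y ⊆ M ∧ (∀ x, (M.filter (x ∈ ends ·)).card ≤ 1) ∧
      ∀ x, ((insideEdges ends D Y \ M).filter (x ∈ ends ·)).card ≤ 2 := by
  let A : Finset V := Y.filter fun x => ∀ e ∈ cutEdges ends D Y, x ∉ ends e
  let T : Finset V := A.filter fun x => (D.filter (x ∈ ends ·)).card = 3
  let D' : Finset E := insideEdges ends D A
  let T' : Set (V ⊕ V) := Sum.inl '' (T : Set V)
  have memT' : ∀ a, Sum.inl a ∈ T' ↔ a ∈ T := by simp [T']
  -- All vertices outside `T'` form a clique. The second copy of `V` only serves to make the number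
  -- of vertices even.
  let H : SimpleGraph (V ⊕ V) :=
    { Adj := fun p q => p ≠ q ∧ ((p ∉ T' ∧ q ∉ T') ∨
        ∃ e ∈ D', ∃ a b, p = Sum.inl a ∧ q = Sum.inl b ∧ ends e = s(a, b))
      symm := ⟨by
        rintro p q ⟨hne, h | ⟨e, he, a, b, rfl, rfl, hab⟩⟩
        · exact ⟨hne.symm, Or.inl h.symm⟩
        · exact ⟨hne.symm, Or.inr ⟨e, he, b, a, rfl, rfl, hab.trans Sym2.eq_swap⟩⟩⟩
      loopless := ⟨fun p h => h.1 rfl⟩ }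
  have htutte : ∃ N : H.Subgraph, N.IsPerfectMatching := by
    rw [SimpleGraph.tutte]
    intro u hu
    unfold SimpleGraph.IsTutteViolator at hu
    let K := ((⊤ : H.Subgraph).deleteVerts u).coe
    change u.ncard < K.oddComponents.ncard at hu
    have adjK : ∀ p q (hp : p ∈ ((⊤ : H.Subgraph).deleteVerts u).verts)
        (hq : q ∈ ((⊤ : H.Subgraph).deleteVerts u).verts), H.Adj p q → K.Adj ⟨p, hp⟩ ⟨q, hq⟩ := by
      intro p q hp hq h
      simp only [SimpleGraph.Subgraph.deleteVerts_verts, SimpleGraph.Subgraph.verts_top,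
        Set.mem_sdiff, Set.mem_univ, true_and] at hp hq
      simp [K, h, hp, hq]
    have hverts : ((⊤ : H.Subgraph).deleteVerts u).verts = uᶜ := by
      ext; simp
    let O : Set K.ConnectedComponent := K.oddComponents
    let O₁ : Set K.ConnectedComponent := {c ∈ O | ∀ p ∈ c.supp, (p : V ⊕ V) ∈ T'}
    let O₂ : Set K.ConnectedComponent := {c ∈ O | ∃ p ∈ c.supp, (p : V ⊕ V) ∉ T'}
    have hO : O ⊆ O₁ ∪ O₂ := by
      intro c hc
      by_cases h : ∀ p ∈ c.supp, (p : V ⊕ V) ∈ T'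
      · exact Or.inl ⟨hc, h⟩
      · push Not at h; exact Or.inr ⟨hc, h⟩
    -- What is left of the clique lies in a single component.
    have hO₂ : O₂.ncard ≤ 1 := by
      rw [Set.ncard_le_one (Set.toFinite _)]
      rintro c ⟨-, p, hp, hpT⟩ c' ⟨-, q, hq, hqT⟩
      rw [SimpleGraph.ConnectedComponent.mem_supp_iff] at hp hq
      rw [← hp, ← hq]
      by_cases hpq : p = q
      · rw [hpq]
      · exact SimpleGraph.ConnectedComponent.sound (SimpleGraph.Adj.reachable
          (adjK _ _ p.2 q.2 ⟨fun h => hpq (Subtype.ext h), Or.inl ⟨hpT, hqT⟩⟩))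
    let Z : K.ConnectedComponent → Finset V := fun c =>
      Finset.univ.filter fun a => ∃ p ∈ c.supp, (p : V ⊕ V) = Sum.inl a
    have memZ : ∀ c a, a ∈ Z c ↔ ∃ p ∈ c.supp, (p : V ⊕ V) = Sum.inl a := fun c a => by simp [Z]
    have hZT : ∀ c ∈ O₁, Z c ⊆ T := by
      intro c hc a ha
      obtain ⟨p, hp, hpa⟩ := (memZ c a).mp ha
      exact (memT' a).mp (hpa ▸ hc.2 p hp)
    let U : Finset V := Finset.univ.filter fun a => Sum.inl a ∈ u
    have hUu : U.card ≤ u.ncard := by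
      rw [← Set.ncard_coe_finset U, ← Set.ncard_image_of_injective (U : Set V)
        (Sum.inl_injective (β := V))]
      refine Set.ncard_le_ncard ?_ (Set.toFinite _)
      rintro _ ⟨a, ha, rfl⟩
      simpa [U] using ha
    have hO₁ : O₁.ncard ≤ U.card := by
      rw [Set.ncard_eq_toFinset_card O₁ (Set.toFinite _)]
      have memO₁ : ∀ c ∈ (Set.toFinite O₁).toFinset, c ∈ O₁ :=
        fun c => (Set.Finite.mem_toFinset _).mp
      refine card_odd_sets_le hl hdeg hY hmin _ Z U ?_ ?_ ?_ ?_ ?_ ?_ ?_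
      · intro c hc a ha
        exact (Finset.mem_filter.mp (Finset.mem_filter.mp (hZT c (memO₁ c hc) ha)).1).1
      · intro c hc a ha
        exact (Finset.mem_filter.mp (Finset.mem_filter.mp (hZT c (memO₁ c hc) ha)).1).2
      · intro c hc a ha
        exact (Finset.mem_filter.mp (hZT c (memO₁ c hc) ha)).2
      · intro c hc
        replace hc := memO₁ c hc
        have hodd : Odd c.supp.ncard := hc.1
        have : c.supp.ncard = (Z c).card := by
          rw [← Set.ncard_image_of_injective c.supp Subtype.val_injective,
            ← Set.ncard_coe_finset (Z c), ← Set.ncard_image_of_injective (Z c : Set V)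
            (Sum.inl_injective (β := V))]
          congr 1
          ext q
          simp only [Set.mem_image, Finset.mem_coe, memZ]
          constructor
          · rintro ⟨p, hp, rfl⟩
            obtain ⟨a, -, ha⟩ := hc.2 p hp
            exact ⟨a, ⟨p, hp, ha.symm⟩, ha⟩
          · rintro ⟨a, ⟨p, hp, hpa⟩, rfl⟩
            exact ⟨p, hp, hpa⟩
        rwa [← this]
      · intro c _ c' _ a ha ha'
        obtain ⟨p, hp, hpa⟩ := (memZ c a).mp ha
        obtain ⟨q, hq, hqa⟩ := (memZ c' a).mp ha'
        have : p = q := Subtype.ext (hpa.trans hqa.symm)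
        subst this
        rw [SimpleGraph.ConnectedComponent.mem_supp_iff] at hp hq
        rw [← hp, ← hq]
      · intro c _ a ha haU
        obtain ⟨p, hp, hpa⟩ := (memZ c a).mp ha
        have h1 := (Set.ext_iff.mp hverts p).mp p.2
        rw [hpa] at h1
        exact h1 (by simpa [U] using haU)
      · intro c hc a ha e heD b hbY hab hb
        by_cases hbU : b ∈ U
        · exact Or.inr hbU
        refine Or.inl ?_
        have haA := (Finset.mem_filter.mp (hZT c (memO₁ c hc) ha)).1
        obtain ⟨p, hp, hpa⟩ := (memZ c a).mp ha
        have hbu : Sum.inl b ∈ ((⊤ : H.Subgraph).deleteVerts u).verts := by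
          rw [hverts]; simpa [U] using hbU
        have hbA : b ∈ A := Finset.mem_filter.mpr ⟨hbY, hb⟩
        have hne : a ≠ b := by have := hl e; rwa [hab, Sym2.mk_isDiag_iff] at this
        have heD' : e ∈ D' := mem_insideEdges.mpr ⟨heD, fun x hx => by
          rw [hab, Sym2.mem_iff] at hx
          rcases hx with rfl | rfl
          exacts [haA, hbA]⟩
        refine (memZ c b).mpr ⟨⟨Sum.inl b, hbu⟩, ?_, rfl⟩
        rw [SimpleGraph.ConnectedComponent.mem_supp_iff] at hp ⊢
        rw [← hp]
        refine SimpleGraph.ConnectedComponent.sound (SimpleGraph.Adj.reachable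
          (adjK _ _ hbu p.2 ?_))
        refine SimpleGraph.Adj.symm ⟨?_, Or.inr ⟨e, heD', a, b, hpa, rfl, hab⟩⟩
        rw [hpa]; simpa using hne
    -- There are at most `u.ncard + 1` odd components, and their number has the parity of `u.ncard`
    -- because `V ⊕ V` has even size. So the excess of one cannot occur.
    have hpar := K.odd_ncard_oddComponents
    have hcard : Nat.card ((⊤ : H.Subgraph).deleteVerts u).verts + u.ncard =
        2 * Fintype.card V := by
      rw [Nat.card_coe_set_eq, hverts, add_comm, Set.ncard_add_ncard_compl,
        Nat.card_eq_fintype_card, Fintype.card_sum, two_mul]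
    have h1 := (Set.ncard_le_ncard hO (Set.toFinite _)).trans (Set.ncard_union_le _ _)
    change K.oddComponents.ncard ≤ _ at h1
    rw [Nat.odd_iff, Nat.odd_iff] at hpar
    omega
  obtain ⟨N, hNm, hNs⟩ := htutte
  -- Choose one edge from each class of parallel edges over a matched pair.
  obtain ⟨s, hsD, hs⟩ := Set.exists_subset_bijOn
    {e | e ∈ D' ∧ ∃ a b, ends e = s(a, b) ∧ N.Adj (Sum.inl a) (Sum.inl b)} ends
  let M₀ : Finset E := D'.filter (· ∈ s)
  have hM₀s : ∀ e, e ∈ M₀ ↔ e ∈ s := fun e => by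
    simp only [M₀, Finset.mem_filter, and_iff_right_iff_imp]
    exact fun h => (hsD h).1
  have hM₀N : ∀ e ∈ M₀, ∀ x ∈ ends e, ∃ b, ends e = s(x, b) ∧ N.Adj (Sum.inl x) (Sum.inl b) := by
    intro e he x hx
    obtain ⟨-, a, b, hab, hN⟩ := hsD ((hM₀s e).mp he)
    rw [hab, Sym2.mem_iff] at hx
    rcases hx with rfl | rfl
    · exact ⟨b, hab, hN⟩
    · exact ⟨a, hab.trans Sym2.eq_swap, hN.symm⟩
  have hA : ∀ e ∈ M₀, ∀ x ∈ ends e, x ∈ A := fun e he =>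
    (mem_insideEdges.mp (Finset.mem_filter.mp he).1).2
  have cross : ∀ e ∈ M₀, ∀ e' ∈ cutEdges ends D Y, ∀ x ∈ ends e, x ∉ ends e' :=
    fun e he e' he' x hx => (Finset.mem_filter.mp (hA e he x hx)).2 e' he'
  have deg_sub : ∀ x e, e ∈ D → x ∈ ends e → (e ∈ M₀ ∪ cutEdges ends D Y) →
      ((insideEdges ends D Y \ (M₀ ∪ cutEdges ends D Y)).filter (x ∈ ends ·)).card ≤ 2 := by
    intro x e heD hxe heM
    have hsub : (insideEdges ends D Y \ (M₀ ∪ cutEdges ends D Y)).filter (x ∈ ends ·) ⊆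
        (D.filter (x ∈ ends ·)).erase e := by
      intro g hg
      rw [Finset.mem_filter, Finset.mem_sdiff, mem_insideEdges] at hg
      refine Finset.mem_erase.mpr ⟨?_, Finset.mem_filter.mpr ⟨hg.1.1.1, hg.2⟩⟩
      rintro rfl
      exact hg.1.2 heM
    have h1 := Finset.card_le_card hsub
    rw [Finset.card_erase_of_mem (Finset.mem_filter.mpr ⟨heD, hxe⟩)] at h1
    have := hdeg x
    omega
  refine ⟨M₀ ∪ cutEdges ends D Y, ?_, Finset.subset_union_right, fun x => ?_, fun x => ?_⟩
  · refine Finset.union_subset_union_left fun e he => ?_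
    exact mem_insideEdges.mpr ⟨(mem_insideEdges.mp (Finset.mem_filter.mp he).1).1, fun x hx =>
      (Finset.mem_filter.mp (hA e he x hx)).1⟩
  · rw [Finset.card_le_one]
    intro e he e' he'
    rw [Finset.mem_filter, Finset.mem_union] at he he'
    rcases he with ⟨he | he, hx⟩ <;> rcases he' with ⟨he' | he', hx'⟩
    · obtain ⟨b, hb, hN⟩ := hM₀N e he x hx
      obtain ⟨b', hb', hN'⟩ := hM₀N e' he' x hx'
      have : Sum.inl b = (Sum.inl b' : V ⊕ V) := (hNm (hNs (Sum.inl x))).unique hN hN'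
      obtain rfl := Sum.inl_injective this
      exact hs.injOn ((hM₀s e).mp he) ((hM₀s e').mp he') (hb.trans hb'.symm)
    · exact absurd hx' (cross e he e' he' x hx)
    · exact absurd hx (cross e' he' e he x hx')
    · exact Finset.card_le_one.mp hY e he e' he'
  · by_cases hxB : ∃ e ∈ cutEdges ends D Y, x ∈ ends e
    · obtain ⟨e, he, hxe⟩ := hxB
      exact deg_sub x e (mem_cutEdges.mp he).1 hxe (Finset.mem_union_right _ he)
    by_cases hx3 : (D.filter (x ∈ ends ·)).card = 3
    · by_cases hxY : x ∈ Y
      · push Not at hxB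
        have hxT : x ∈ T := Finset.mem_filter.mpr ⟨Finset.mem_filter.mpr ⟨hxY, hxB⟩, hx3⟩
        obtain ⟨q, hq, -⟩ := hNm (hNs (Sum.inl x))
        obtain ⟨-, h | ⟨e, he, a, b, hxa, rfl, hab⟩⟩ := N.adj_sub hq
        · exact absurd ((memT' x).mpr hxT) h.1
        · obtain rfl := Sum.inl_injective hxa
          have hmem : ends e ∈ ends '' s := by
            rw [hs.image_eq]
            exact ⟨e, ⟨he, x, b, hab, hq⟩, rfl⟩
          obtain ⟨e', he', hee'⟩ := hmem
          have he'M : e' ∈ M₀ := (hM₀s e').mpr he'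
          exact deg_sub x e' (mem_insideEdges.mp (Finset.mem_filter.mp he'M).1).1
            (by simp [hee', hab])
            (Finset.mem_union_left _ he'M)
      · rw [Finset.filter_false_of_mem]
        · simp
        · intro e he hxe
          exact hxY ((mem_insideEdges.mp (Finset.mem_sdiff.mp he).1).2 x hxe)
    · have h1 := hdeg x
      refine (Finset.card_le_card (Finset.filter_subset_filter _ (Finset.sdiff_subset.trans
        (insideEdges_subset _ _ _)))).trans (show (D.filter (x ∈ ends ·)).card ≤ 2 by omega)

end

/-! ### The induction over vertex sets. -/

section

variable {ends : E → Sym2 V} {D : Finset E}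
  (hdeg : ∀ x, (D.filter (x ∈ ends ·)).card ≤ 3)

include hdeg

/-- Through one of its ends, an edge `e` sees at most six other edges within distance two. -/
theorem card_near_le {D' : Finset E} (hD' : D' ⊆ D) {e : E} (heD : e ∈ D) (he : e ∉ D') {u : V}
    (hu : u ∈ ends e) (hD'u : ∀ g ∈ D', ∀ x ∈ ends g, x ∈ ends e → x = u) :
    (D'.filter fun h => ∃ g ∈ D', Touch ends e g ∧ Touch ends g h).card ≤ 6 := by
  let G : Finset E := (D.filter (u ∈ ends ·)).erase e
  have hG : G.card ≤ 2 := by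
    have h1 := Finset.card_erase_of_mem
      (show e ∈ D.filter (u ∈ ends ·) from Finset.mem_filter.mpr ⟨heD, hu⟩)
    have h2 := hdeg u
    change G.card = _ at h1
    omega
  have memG : ∀ g ∈ D', u ∈ ends g → g ∈ G := fun g hg hug =>
    Finset.mem_erase.mpr ⟨by rintro rfl; exact he hg, Finset.mem_filter.mpr ⟨hD' hg, hug⟩⟩
  -- `B g` consists of the edges at the far end of `g`. The bound six is two edges `g` at `u` times
  -- three edges at each far end.
  let B : E → Finset E := fun g => D.filter fun h => ∃ w, ends g = s(u, w) ∧ w ∈ ends h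
  have hB : ∀ g ∈ G, (B g).card ≤ 3 := by
    intro g hg
    obtain ⟨w, hw⟩ := Sym2.mem_iff_exists.mp (Finset.mem_filter.mp (Finset.mem_erase.mp hg).2).2
    refine (Finset.card_le_card fun h hh => ?_).trans (hdeg w)
    obtain ⟨hh, w', hw', hwh⟩ := Finset.mem_filter.mp hh
    rw [hw, Sym2.congr_right] at hw'
    exact Finset.mem_filter.mpr ⟨hh, hw' ▸ hwh⟩
  have hsub : (D'.filter fun h => ∃ g ∈ D', Touch ends e g ∧ Touch ends g h) ⊆ G.biUnion B := by
    intro h hh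
    obtain ⟨hh, g, hg, ⟨x, hxe, hxg⟩, y, hyg, hyh⟩ := Finset.mem_filter.mp hh
    obtain rfl := hD'u g hg x hxg hxe
    by_cases hxh : x ∈ ends h
    · obtain ⟨w, hw⟩ := Sym2.mem_iff_exists.mp hxh
      exact Finset.mem_biUnion.mpr ⟨h, memG h hh hxh,
        Finset.mem_filter.mpr ⟨hD' hh, w, hw, by simp [hw]⟩⟩
    · obtain ⟨w, hw⟩ := Sym2.mem_iff_exists.mp hxg
      refine Finset.mem_biUnion.mpr ⟨g, memG g hg hxg, Finset.mem_filter.mpr ⟨hD' hh, w, hw, ?_⟩⟩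
      rw [hw, Sym2.mem_iff] at hyg
      rcases hyg with rfl | rfl
      · exact absurd hyh hxh
      · exact hyh
  refine (Finset.card_le_card hsub).trans ((Finset.card_biUnion_le_card_mul _ _ 3 hB).trans ?_)
  omega

/-- The subgraph induced on any set `X` of vertices is star edge-colorable from lists of seven
colors. -/
theorem exists_isStarOn_insideEdges [Fintype V] [Nonempty C] (hl : ∀ e, ¬ (ends e).IsDiag)
    {L : E → Finset C} (hL : ∀ e ∈ D, 7 ≤ (L e).card) (X : Finset V) :
    ∃ σ : E → C, IsStarOn ends (insideEdges ends D X) σ ∧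
      ∀ e ∈ insideEdges ends D X, σ e ∈ L e := by
  induction hk : X.card using Nat.strong_induction_on generalizing X with
  | _ k ih =>
  subst hk
  rcases X.eq_empty_or_nonempty with rfl | hX
  · have : insideEdges ends D ∅ = ∅ := by
      refine Finset.eq_empty_of_forall_notMem fun e he => ?_
      obtain ⟨x, hx, -⟩ := Touch.refl ends e
      exact Finset.notMem_empty _ ((mem_insideEdges.mp he).2 x hx)
    rw [this]
    exact ⟨fun _ => Classical.arbitrary C, ⟨by simp, by simp⟩, by simp⟩
  let DX := insideEdges ends D X
  have hDXD : DX ⊆ D := insideEdges_subset _ _ _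
  have hdegX : ∀ x, (DX.filter (x ∈ ends ·)).card ≤ 3 := fun x =>
    (Finset.card_le_card (Finset.filter_subset_filter _ hDXD)).trans (hdeg x)
  have hDX : ∀ e ∈ DX, ∀ x ∈ ends e, x ∈ X := fun e he => (mem_insideEdges.mp he).2
  -- The whole of `X` is a candidate, since no edge of `DX` leaves it.
  obtain ⟨Y, hY, hYmin⟩ := Finset.exists_min_image
    (X.powerset.filter fun Z => Z.Nonempty ∧ (cutEdges ends DX Z).card ≤ 1) Finset.card ⟨X, by
      simp only [Finset.mem_filter, Finset.mem_powerset, subset_rfl, hX, true_and]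
      rw [show cutEdges ends DX X = ∅ from Finset.eq_empty_of_forall_notMem fun e he => by
        obtain ⟨he, -, y, hy, hye⟩ := mem_cutEdges.mp he
        exact hy (hDX e he y hye)]
      simp⟩
  obtain ⟨hYX, hYne, hYcut⟩ : Y ⊆ X ∧ Y.Nonempty ∧ (cutEdges ends DX Y).card ≤ 1 := by
    simpa using hY
  have hmin : ∀ Z ⊂ Y, Z.Nonempty → 2 ≤ (cutEdges ends DX Z).card := by
    intro Z hZ hne
    by_contra! hlt
    have := hYmin Z (by simpa using ⟨hZ.1.trans hYX, hne, by omega⟩)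
    exact absurd (Finset.card_lt_card hZ) (by omega)
  obtain ⟨σ₀, hσ₀, hσ₀L⟩ := ih _ (Finset.card_lt_card (Finset.sdiff_ssubset hYX hYne)) (X \ Y) rfl
  obtain ⟨M, hMsub, hPM, hM, hF⟩ := exists_matching_covering hl hdegX hYcut hmin
  let S' := insideEdges ends D (X \ Y)
  have hS' : ∀ e ∈ S', ∀ x ∈ ends e, x ∈ X ∧ x ∉ Y := fun e he x hx => by
    simpa using (mem_insideEdges.mp he).2 x hx
  have hS'D : S' ⊆ D := insideEdges_subset _ _ _
  let P := cutEdges ends DX Y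
  let F := insideEdges ends DX Y \ M
  have hMF : M ∪ F = insideEdges ends DX Y ∪ P := by
    ext e
    have h1 := @hMsub e
    have h2 := @hPM e
    simp only [F, P, Finset.mem_union, Finset.mem_sdiff] at h1 h2 ⊢
    tauto
  have hSD : M ∪ F ⊆ D := by
    rw [hMF]
    exact Finset.union_subset ((insideEdges_subset _ _ _).trans hDXD)
      ((cutEdges_subset _ _ _).trans hDXD)
  have hSY : ∀ e ∈ M ∪ F, ∃ x ∈ ends e, x ∈ Y := by
    intro e he
    rw [hMF, Finset.mem_union] at he
    rcases he with he | he
    · obtain ⟨x, hx, -⟩ := Touch.refl ends e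
      exact ⟨x, hx, (mem_insideEdges.mp he).2 x hx⟩
    · obtain ⟨-, ⟨x, hx, hxe⟩, -⟩ := mem_cutEdges.mp he
      exact ⟨x, hxe, hx⟩
  have hdisj : ∀ e ∈ M ∪ F, e ∉ S' := fun e he he' => by
    obtain ⟨x, hx, hxY⟩ := hSY e he
    exact (hS' e he' x hx).2 hxY
  have hcover : ∀ e ∈ DX, e ∈ S' ∨ e ∈ M ∪ F := by
    intro e he
    rw [hMF, Finset.mem_union]
    by_cases h1 : ∃ x ∈ Y, x ∈ ends e
    · by_cases h2 : ∃ y ∉ Y, y ∈ ends e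
      · exact Or.inr (Or.inr (mem_cutEdges.mpr ⟨he, h1, h2⟩))
      · push Not at h2
        exact Or.inr (Or.inl (mem_insideEdges.mpr ⟨he, fun x hx => by
          by_contra hxY; exact h2 x hxY hx⟩))
    · push Not at h1
      exact Or.inl (mem_insideEdges.mpr ⟨hDXD he, fun x hx =>
        Finset.mem_sdiff.mpr ⟨hDX e he x hx, fun h => h1 x h hx⟩⟩)
  have hPS : P ⊆ M ∪ F := hPM.trans Finset.subset_union_left
  have touchP : ∀ h ∈ S', ∀ g ∈ M ∪ F, Touch ends h g → g ∈ P := by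
    rintro h hh g hg ⟨x, hxh, hxg⟩
    rw [hMF, Finset.mem_union] at hg
    exact hg.resolve_left fun hg => (hS' h hh x hxh).2 ((mem_insideEdges.mp hg).2 x hxg)
  -- The cut edge, if there is one, is colored against the part outside `Y`, where it sees at most
  -- six edges. It is then the precolored edge of `M`.
  obtain ⟨σ₁, hσ₁, hσ₁L, hσ₁P⟩ : ∃ σ₁ : E → C, (∀ h ∈ S', σ₁ h = σ₀ h) ∧ (∀ e ∈ P, σ₁ e ∈ L e) ∧
      ∀ e ∈ P, ∀ h ∈ S', ∀ g ∈ S', Touch ends e g → Touch ends g h → σ₁ e ≠ σ₁ h := by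
    rcases P.eq_empty_or_nonempty with hP0 | ⟨e, he⟩
    · exact ⟨σ₀, fun _ _ => rfl, by simp [hP0], by simp [hP0]⟩
    · have hPe : ∀ e' ∈ P, e' = e := fun e' he' => Finset.card_le_one.mp hYcut e' he' e he
      obtain ⟨heDX, ⟨v, hvY, hve⟩, u, huY, hue⟩ := mem_cutEdges.mp he
      have heS' := hdisj e (hPS he)
      have hcard := card_near_le hdeg hS'D (hDXD heDX) heS' hue (by
        intro g hg x hxg hxe
        obtain ⟨w, hw⟩ := Sym2.mem_iff_exists.mp hve
        have hxY := (hS' g hg x hxg).2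
        rw [hw, Sym2.mem_iff] at hxe hue
        rw [hxe.resolve_left (by rintro rfl; exact hxY hvY),
          hue.resolve_left (by rintro rfl; exact huY hvY)])
      obtain ⟨z, hzL, hz⟩ := exists_mem_notMem_of_card_lt (s := L e) ((Finset.card_image_le
        (f := σ₀)).trans_lt (hcard.trans_lt (hL e (hDXD heDX))))
      refine ⟨Function.update σ₀ e z, fun h hh => Function.update_of_ne ?_ _ _, ?_, ?_⟩
      · rintro rfl; exact heS' hh
      · intro e' he'
        rw [hPe e' he', Function.update_self]; exact hzL
      · intro e' he' h hh g hg h1 h2 heq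
        rw [hPe e' he'] at heq h1
        rw [Function.update_self, Function.update_of_ne (by rintro rfl; exact heS' hh)] at heq
        exact hz (Finset.mem_image.mpr ⟨h, Finset.mem_filter.mpr ⟨hh, g, hg, h1, h2⟩, heq.symm⟩)
  obtain ⟨τ, hτP, hτL, hτ, hτM⟩ := exists_isStarOn_union hM hF hl (L := L)
    Finset.disjoint_sdiff hPM hYcut (fun e he => hL e (hSD (Finset.mem_sdiff.mp he).1)) σ₁
  let σ : E → C := fun e => if e ∈ S' then σ₀ e else τ e
  have σS' : ∀ e ∈ S', σ e = σ₀ e := fun e he => if_pos he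
  have σS : ∀ e ∈ M ∪ F, σ e = τ e := fun e he => if_neg (hdisj e he)
  -- The color of the cut edge recurs on neither side within distance two. An alternating quad
  -- therefore avoids it and stays on one side.
  have strong : ∀ e ∈ P, ∀ h ∈ DX, e ≠ h → ∀ g ∈ DX, Touch ends e g → Touch ends g h →
      σ e ≠ σ h := by
    intro e he h hh hne g hg heg hgh
    have old : ∀ h ∈ S', ∀ g ∈ S', Touch ends e g → Touch ends g h → σ e ≠ σ h := by
      intro h hh g hg heg hgh
      rw [σS e (hPS he), hτP e he, σS' h hh, ← hσ₁ h hh]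
      exact hσ₁P e he h hh g hg heg hgh
    rcases hcover h hh with hh | hh <;> rcases hcover g hg with hg | hg
    · exact old h hh g hg heg hgh
    · obtain rfl := Finset.card_le_one.mp hYcut g (touchP h hh g hg hgh.symm) e he
      exact old h hh h hh hgh (Touch.refl _ _)
    · exact absurd (Finset.card_le_one.mp hYcut e he h (touchP g hg h hh hgh)) hne
    · rw [σS e (hPS he), σS h hh]
      exact hτM e (hPM he) h hh hne g hg heg hgh
  have same : ∀ a ∈ DX, ∀ b ∈ DX, a ∉ P → b ∉ P → Touch ends a b → (a ∈ S' ↔ b ∈ S') := by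
    intro a ha b hb haP hbP hab
    constructor
    · intro h
      exact (hcover b hb).resolve_right fun h' => hbP (touchP a h b h' hab)
    · intro h
      exact (hcover a ha).resolve_right fun h' => haP (touchP b h a h' hab.symm)
  refine ⟨σ, ⟨?_, ?_⟩, ?_⟩
  · intro a ha b hb hab ht
    by_cases haP : a ∈ P
    · exact strong a haP b hb hab b hb ht (Touch.refl _ _)
    by_cases hbP : b ∈ P
    · exact (strong b hbP a ha hab.symm a ha ht.symm (Touch.refl _ _)).symm
    have hs := same a ha b hb haP hbP ht
    by_cases h : a ∈ S'
    · rw [σS' a h, σS' b (hs.mp h)]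
      exact hσ₀.ne a h b (hs.mp h) hab ht
    · have ha' := (hcover a ha).resolve_left h
      have hb' := (hcover b hb).resolve_left fun h' => h (hs.mpr h')
      rw [σS a ha', σS b hb']
      exact hτ.ne a ha' b hb' hab ht
  · rintro a ha b hb c hc d hd hq ⟨e1, e2⟩
    obtain ⟨-, ⟨hac, hbd⟩, tab, tbc, tcd⟩ := hq.facts
    have haP : a ∉ P := fun h => strong a h c hc hac b hb tab tbc e1
    have hcP : c ∉ P := fun h => strong c h a ha hac.symm b hb tbc.symm tab.symm e1.symm
    have hbP : b ∉ P := fun h => strong b h d hd hbd c hc tbc tcd e2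
    have hdP : d ∉ P := fun h => strong d h b hb hbd.symm c hc tcd.symm tbc.symm e2.symm
    have s1 := same a ha b hb haP hbP tab
    have s2 := s1.trans (same b hb c hc hbP hcP tbc)
    have s3 := s2.trans (same c hc d hd hcP hdP tcd)
    by_cases h : a ∈ S'
    · have hb' := s1.mp h
      have hc' := s2.mp h
      have hd' := s3.mp h
      rw [σS' a h, σS' c hc'] at e1
      rw [σS' b hb', σS' d hd'] at e2
      exact hσ₀.quad a h b hb' c hc' d hd' hq ⟨e1, e2⟩
    · have ha' := (hcover a ha).resolve_left h
      have hb' := (hcover b hb).resolve_left fun h' => h (s1.mpr h')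
      have hc' := (hcover c hc).resolve_left fun h' => h (s2.mpr h')
      have hd' := (hcover d hd).resolve_left fun h' => h (s3.mpr h')
      rw [σS a ha', σS c hc'] at e1
      rw [σS b hb', σS d hd'] at e2
      exact hτ.quad a ha' b hb' c hc' d hd' hq ⟨e1, e2⟩
  · intro e he
    rcases hcover e he with h | h
    · rw [σS' e h]; exact hσ₀L e h
    · rw [σS e h]
      by_cases heP : e ∈ P
      · rw [hτP e heP]; exact hσ₁L e heP
      · exact hτL e (Finset.mem_sdiff.mpr ⟨h, heP⟩)

end

end StarColoring

/-! ### Transfer to `Graph`. -/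

namespace Graph

theorem encard_incidenceSet_le {α : Type*} {β : Type*} {G : Graph α β} {n : ℕ∞}
    (hdeg : G.maxDegree ≤ n) {x : α} (hx : x ∈ G.vertexSet) : (G.incidenceSet x).encard ≤ n :=
  le_self_add.trans ((le_iSup₂ (f := fun x (_ : x ∈ G.vertexSet) => G.degree x) x hx).trans hdeg)

theorem edgeSet_finite_of_maxDegree_le {α : Type*} {β : Type*} {G : Graph α β} {n : ℕ}
    (hfin : G.vertexSet.Finite) (hdeg : G.maxDegree ≤ n) : G.edgeSet.Finite := by
  refine (hfin.biUnion fun x hx => Set.finite_of_encard_le_coe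
    (encard_incidenceSet_le hdeg hx)).subset fun e he => ?_
  obtain ⟨x, y, h⟩ := G.exists_isLink_of_mem_edgeSet he
  exact Set.mem_biUnion h.left_mem ⟨y, h⟩

open scoped Classical in
theorem isStarEdgeChoosable_seven {α : Type*} {β : Type*} (G : Graph α β)
    (hfin : G.vertexSet.Finite) (hloop : G.Loopless) (hdeg : G.maxDegree ≤ 3) :
    IsStarEdgeChoosable G 7 := by
  intro C L hL
  rcases isEmpty_or_nonempty G.edgeSet with hE | ⟨⟨e₀⟩⟩
  · exact ⟨fun e => hE.elim e, ⟨fun e => hE.elim e, fun e => hE.elim (e 0), fun e => hE.elim (e 0)⟩,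
      fun e => hE.elim e⟩
  have : Nonempty C := (Finset.card_pos.mp (by have := hL e₀; omega : 0 < (L e₀).card)).to_type
  have := hfin.fintype
  have := (edgeSet_finite_of_maxDegree_le hfin hdeg).fintype
  have hlink : ∀ e : G.edgeSet, ∃ p : G.vertexSet × G.vertexSet, G.IsLink e p.1 p.2 := by
    rintro ⟨e, he⟩
    obtain ⟨x, y, h⟩ := G.exists_isLink_of_mem_edgeSet he
    exact ⟨⟨⟨x, h.left_mem⟩, ⟨y, h.right_mem⟩⟩, h⟩
  choose p hp using hlink
  let ends : G.edgeSet → Sym2 G.vertexSet := fun e => s((p e).1, (p e).2)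
  have ends_eq : ∀ (e : G.edgeSet) (x y : G.vertexSet), G.IsLink e x y → ends e = s(x, y) := by
    intro e x y h
    rw [Sym2.eq_iff, Subtype.ext_iff, Subtype.ext_iff, Subtype.ext_iff, Subtype.ext_iff]
    exact (hp e).eq_and_eq_or_eq_and_eq h
  have mem_ends : ∀ (e : G.edgeSet) (x : G.vertexSet), x ∈ ends e ↔ G.Inc e x := by
    intro e x
    constructor
    · intro h
      rcases Sym2.mem_iff.mp h with rfl | rfl
      · exact ⟨_, hp e⟩
      · exact ⟨_, (hp e).symm⟩
    · rintro ⟨y, h⟩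
      rw [ends_eq e x ⟨y, h.right_mem⟩ h]
      exact Sym2.mem_mk_left _ _
  have hl : ∀ e, ¬ (ends e).IsDiag := fun e h =>
    (hp e).ne (congrArg Subtype.val (Sym2.mk_isDiag_iff.mp h))
  have hdeg' : ∀ x, ((Finset.univ : Finset G.edgeSet).filter (x ∈ ends ·)).card ≤ 3 := by
    intro x
    have h1 := encard_incidenceSet_le hdeg x.2
    have h2 : Subtype.val ''
        ((Finset.univ.filter (x ∈ ends ·) : Finset G.edgeSet) : Set G.edgeSet) ⊆
        G.incidenceSet x := by
      rintro _ ⟨e, he, rfl⟩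
      exact (mem_ends e x).mp (by simpa using he)
    have h3 := (Set.encard_le_encard h2).trans h1
    rw [Subtype.val_injective.encard_image, Set.encard_coe_eq_coe_finsetCard] at h3
    exact_mod_cast h3
  obtain ⟨σ, hσ, hσL⟩ := exists_isStarOn_insideEdges (D := Finset.univ)
    (fun x => by convert hdeg' x) hl (L := L)
    (fun e _ => hL e) Finset.univ
  have mem : ∀ e, e ∈ insideEdges ends Finset.univ Finset.univ := fun e => by simp [insideEdges]
  -- With only two colors available, properness forces the quad to alternate.
  have quad : ∀ (e : Fin 4 → G.edgeSet), IsQuad ends (e 0) (e 1) (e 2) (e 3) →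
      ¬ IsBichromatic σ e := by
    rintro e hq ⟨a, b, hab⟩
    obtain ⟨⟨h1, h2, h3⟩, -, t1, t2, t3⟩ := hq.facts
    have n1 := hσ.ne _ (mem _) _ (mem _) h1 t1
    have n2 := hσ.ne _ (mem _) _ (mem _) h2 t2
    have n3 := hσ.ne _ (mem _) _ (mem _) h3 t3
    have h0 := hab 0
    have h1 := hab 1
    have h2 := hab 2
    have h3 := hab 3
    exact hσ.quad _ (mem _) _ (mem _) _ (mem _) _ (mem _) hq (by grind)
  refine ⟨σ, ⟨?_, ?_, ?_⟩, fun e => hσL e (mem e)⟩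
  · rintro e f x hne he hf
    have hx : x ∈ G.vertexSet := he.vertex_mem
    exact hσ.ne e (mem e) f (mem f) hne
      ⟨⟨x, hx⟩, (mem_ends e ⟨x, hx⟩).mpr he, (mem_ends f ⟨x, hx⟩).mpr hf⟩
  · rintro e ⟨x, hx, he⟩
    refine quad e ?_
    have h : ∀ i j : Fin 5, i ≠ j → ∀ hi hj, (⟨x i, hi⟩ : G.vertexSet) ≠ ⟨x j, hj⟩ :=
      fun i j hij hi hj h => hij (hx (congrArg Subtype.val h))
    refine ⟨⟨x 0, (he 0).left_mem⟩, ⟨x 1, (he 1).left_mem⟩, ⟨x 2, (he 2).left_mem⟩,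
      ⟨x 3, (he 3).left_mem⟩, ⟨x 4, (he 3).right_mem⟩, ends_eq _ _ _ (he 0), ends_eq _ _ _ (he 1),
      ends_eq _ _ _ (he 2), ends_eq _ _ _ (he 3), ?_⟩
    refine ⟨?_, ?_, ?_, ?_, ?_, ?_, ?_, ?_, ?_⟩ <;> exact h _ _ (by decide) _ _
  · rintro e ⟨x, hx, he⟩
    refine quad e ?_
    have h : ∀ i j : Fin 4, i ≠ j → ∀ hi hj, (⟨x i, hi⟩ : G.vertexSet) ≠ ⟨x j, hj⟩ :=
      fun i j hij hi hj h => hij (hx (congrArg Subtype.val h))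
    -- The fifth vertex is again `x 0`: `IsQuad` does not ask its first and last vertices to differ.
    refine ⟨⟨x 0, (he 0).left_mem⟩, ⟨x 1, (he 1).left_mem⟩, ⟨x 2, (he 2).left_mem⟩,
      ⟨x 3, (he 3).left_mem⟩, ⟨x 0, (he 0).left_mem⟩, ends_eq _ _ _ (he 0), ends_eq _ _ _ (he 1),
      ends_eq _ _ _ (he 2), ends_eq _ _ _ (he 3), ?_⟩
    refine ⟨?_, ?_, ?_, ?_, ?_, ?_, ?_, ?_, ?_⟩ <;> exact h _ _ (by decide) _ _

end Graph

theorem theorem1p5 {α : Type u} {β : Type v} (G : Graph α β) (hfin : G.vertexSet.Finite)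
    (hloop : G.Loopless) (hdeg : G.maxDegree ≤ 3) :
    Graph.IsStarEdgeChoosable.{u, v, w} G 7 ∧
      Graph.listStarChromaticIndex.{u, v, w} G ≤ 7 := by
  have h : Graph.IsStarEdgeChoosable.{u, v, w} G 7 := G.isStarEdgeChoosable_seven hfin hloop hdeg
  exact ⟨h, iInf₂_le (f := fun (k : ℕ) (_ : Graph.IsStarEdgeChoosable.{u, v, w} G k) =>
    (k : ℕ∞)) 7 h⟩
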